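/- Let $k\ge 1$ and let $X=(V,E)$ be a finite connected $k$-regular graph with adjacency matrix $A$, Laplacian $L=kI-A$ and signless Laplacian $Q=kI+A$. Let $a\in V$ be the only marked vertex. Let $R$ be the permutation matrix on the arcs $(u,v)$ of $X$ (ordered pairs of adjacent vertices) that swaps $(u,v)$ and $(v,u)$, let $D_t$ be the tail-arc incidence matrix ($(D_t)_{w,(u,v)}=1$ if $w=u$, and $0$ otherwise), let $O$ be the identity matrix on $V$ with its $(a,a)$-entry replaced by $0$, and let $$U=R\left(\tfrac2k D_t^TOD_t-I\right)$$ be the transition matrix of the quantum walk with marked vertex $a$. The average return probability of $a$ is $$\widehat M_{a,a}=\lim_{T\to\infty}\frac1T\sum_{t=0}^{T-1}\ \sum_{v\sim a}\left|\left(U^t x\right)_{(a,v)}\right|^2,\qquad x=\tfrac1{\sqrt k}D_t^Te_a .$$ Let $L\backslash a$ and $Q\backslash a$ be obtained from $L$ and $Q$ by deleting the row and column of $a$, and let $A(X\backslash a)=\sum_r\lambda_rG_r$ be the spectral decomposition of the adjacency matrix of the vertex-deleted graph $X\backslash a$ ($\lambda_r$ the distinct eigenvalues, $G_r$ the orthogonal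 projections onto the eigenspaces). Let $N(a)$ be the set of neighbors of $a$, let $\mathrm{elsm}_{N(a)}(N)=\sum_{u,v\in N(a)}N_{u,v}$, let $J$ be the all-ones matrix and $N^{\circ 2}$ the entrywise square of $N$. Write $Q^{-1}_{a,a}=(Q^{-1})_{a,a}$. Then the limit $\widehat M_{a,a}$ exists, $L\backslash a$ and $Q\backslash a$ are invertible, $|\lambda_r|<k$ for all $r$, and the following hold. (i) If $X$ is bipartite, then $$\widehat M_{a,a}\ \ge\ \frac12\sum_r\frac{\left(\mathrm{elsm}_{N(a)}(G_r)\right)^2}{(k^2-\lambda_r^2)^2} =\frac12\mathrm{elsm}_{N(a)}\Big(\sum_r\frac{1}{(k+\lambda_r)^2}G_rJG_r\Big) =\frac12\mathrm{elsm}_{N(a)}\Big((Q\backslash a)^{-1}\Big(\sum_rG_rJG_r\Big)(Q\backslash a)^{-1}\Big)$$ and $$\widehat M_{a,a}\ \le\ \frac12\mathrm{elsm}_{N(a)}\Big(\sum_r\frac{k^2}{(k^2-\lambda_r^2)^2}G_r^{\circ2}+\big((L\backslash a)^{-1}\big)^{\circ2}\Big)-\frac12 =\frac12\mathrm{elsm}_{N(a)}\Big(k^2\sum_r\big((L\backslash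 a)^{-1}(Q\backslash a)^{-1}G_r\big)^{\circ2}+\big((L\backslash a)^{-1}\big)^{\circ2}\Big)-\frac12 .$$ (ii) If $X$ is non-bipartite, then $Q$ is invertible, $Q^{-1}_{a,a}>0$, $$\begin{aligned}\widehat M_{a,a}&\ge\frac12\sum_r\frac{\left(\mathrm{elsm}_{N(a)}(G_r)\right)^2}{(k^2-\lambda_r^2)^2}+\frac{1}{4k^2(Q^{-1}_{a,a})^2} =\frac12\sum_r\frac{1}{(k+\lambda_r)^2}\mathrm{elsm}_{N(a)}(G_rJG_r)+\frac{1}{4k^2(Q^{-1}_{a,a})^2}\\ &=\frac12\mathrm{elsm}_{N(a)}\Big((Q\backslash a)^{-1}\Big(\sum_rG_rJG_r\Big)(Q\backslash a)^{-1}\Big)+\frac{1}{4k^2(Q^{-1}_{a,a})^2}\end{aligned}$$ and $$\begin{aligned}\widehat M_{a,a}&\le\frac14\mathrm{elsm}_{N(a)}\Big(\sum_r\frac{2k^2}{(k^2-\lambda_r^2)^2}G_r^{\circ2}+\big((L\backslash a)^{-1}\big)^{\circ2}+\big((Q\backslash a)^{-1}\big)^{\circ2}\Big)+\frac1{2kQ^{-1}_{a,a}}-\frac12\\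 &=\frac14\mathrm{elsm}_{N(a)}\Big(2k^2\sum_r\big((L\backslash a)^{-1}(Q\backslash a)^{-1}G_r\big)^{\circ2}+\big((L\backslash a)^{-1}\big)^{\circ2}+\big((Q\backslash a)^{-1}\big)^{\circ2}\Big)+\frac1{2kQ^{-1}_{a,a}}-\frac12\\ &\le\frac12\mathrm{elsm}_{N(a)}\Big(k^2\sum_r\big((L\backslash a)^{-1}(Q\backslash a)^{-1}G_r\big)^{\circ2}+\big((L\backslash a)^{-1}\big)^{\circ2}\Big)+\frac1{2kQ^{-1}_{a,a}}-\frac12 .\end{aligned}$$ Moreover, in each case, $\widehat M_{a,a}$ equals the lower bound if and only if for every integer $m\ge0$ the number of walks of length $m$ in $X\backslash a$ from $w$ to $N(a)$ is the same for all $w\in N(a)$; and $\widehat M_{a,a}$ equals the (first) upper bound if and only if $X\cong K_2$. -/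

import Mathlib

open Filter Topology
open scoped Matrix

noncomputable section

namespace MarkedWalk

section Walk

variable {V : Type*} [Fintype V] [DecidableEq V] (X : SimpleGraph V) [DecidableRel X.Adj]

/-- The arc-reversal matrix `R`: the permutation matrix swapping `(u,v)` and `(v,u)`.
Arcs are the darts of `X`; the tail of a dart `e` is `e.fst`, its head is `e.snd`. -/
def arcReversal : Matrix X.Dart X.Dart ℂ :=
  Matrix.of fun e f => if e = f.symm then 1 else 0

/-- The tail-arc incidence matrix `D_t`. -/
def tailArc : Matrix V X.Dart ℂ :=
  Matrix.of fun u e => if u = e.fst then 1 else 0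

/-- `O_S`: the identity matrix with its `[S,S]`-block zeroed out. -/
def unmarkedDiag (S : Finset V) : Matrix V V ℂ :=
  Matrix.diagonal fun v => if v ∈ S then 0 else 1

/-- `Δ^{-1/2}`, where `Δ` is the degree matrix. -/
def degInvSqrt : Matrix V V ℂ :=
  Matrix.diagonal fun v => (((Real.sqrt (X.degree v))⁻¹ : ℝ) : ℂ)

/-- The transition matrix `U = R (2 D_tᵀ Δ^{-1/2} O_S Δ^{-1/2} D_t - I)` of the walk with set `S`
of marked vertices. -/
def transition (S : Finset V) : Matrix X.Dart X.Dart ℂ :=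
  arcReversal X *
    ((2 : ℂ) • ((tailArc X)ᵀ * degInvSqrt X * unmarkedDiag S * degInvSqrt X * tailArc X) - 1)

/-- The uniform unit state `(deg v)^{-1/2} D_tᵀ e_v` on the outgoing arcs of `v`. -/
def startState (v : V) : X.Dart → ℂ :=
  (((Real.sqrt (X.degree v))⁻¹ : ℝ) : ℂ) • ((tailArc X)ᵀ *ᵥ Pi.single v 1)

/-- The probability that the walk started in the uniform state at `v` is, after `t` steps, on an
outgoing arc of `u`. -/
def stepProb (S : Finset V) (u v : V) (t : ℕ) : ℝ :=
  ∑ e : X.Dart with e.fst = u, ‖((transition X S ^ t) *ᵥ startState X v) e‖ ^ 2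

/-- The average of `stepProb` over the times `0, …, T - 1`. -/
def timeAverage (S : Finset V) (u v : V) (T : ℕ) : ℝ :=
  1 / (T : ℝ) * ∑ t ∈ Finset.range T, stepProb X S u v t

/-- The average vertex mixing matrix `M̂`. -/
def avgMixing (S : Finset V) : Matrix V V ℝ :=
  Matrix.of fun u v => limUnder atTop (timeAverage X S u v)

/-- The signless Laplacian `Q = Δ + A`. -/
def signlessLap : Matrix V V ℝ := X.degMatrix ℝ + X.adjMatrix ℝ

end Walk

section Deleted

variable {V : Type*} (X : SimpleGraph V) (a : V)

/-- The vertex-deleted subgraph `X \ a`. -/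
abbrev deleteVertex : SimpleGraph {v : V // v ≠ a} := X.comap Subtype.val

/-- The principal submatrix of `N` obtained by deleting the row and the column of `a`. -/
def minorAt (N : Matrix V V ℝ) : Matrix {v : V // v ≠ a} {v : V // v ≠ a} ℝ :=
  N.submatrix Subtype.val Subtype.val

/-- The neighborhood `N(a)`, as a set of vertices of `X \ a`. -/
def nbrs [Fintype V] [DecidableEq V] [DecidableRel X.Adj] : Finset {v : V // v ≠ a} :=
  Finset.univ.filter fun w => X.Adj a w

end Deleted

section Matrices

variable {W : Type*} [Fintype W] [DecidableEq W]

/-- The finite set of distinct eigenvalues `λ_r` of a real matrix. -/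
def eigvals (A : Matrix W W ℝ) : Finset ℝ := (Matrix.finite_spectrum A).toFinset

/-- The eigenprojection `G_r` of `A` at `μ = λ_r`: the matrix of the orthogonal projection onto the
`μ`-eigenspace of `A`. -/
def eigproj (A : Matrix W W ℝ) (μ : ℝ) : Matrix W W ℝ :=
  (Matrix.toEuclideanCLM (n := W) (𝕜 := ℝ)).symm
    (Module.End.eigenspace (Matrix.toEuclideanLin A) μ).starProjection

/-- The all-ones matrix `J`. -/
def allOnes : Matrix W W ℝ := Matrix.of fun _ _ => 1

/-- The Schur (entrywise) square `N^{∘2}`. -/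
def schurSq (N : Matrix W W ℝ) : Matrix W W ℝ := Matrix.hadamard N N

/-- The sum of the entries of the principal submatrix of `N` indexed by `T`. -/
def elsm (T : Finset W) (N : Matrix W W ℝ) : ℝ := ∑ i ∈ T, ∑ j ∈ T, N i j

/-- The number of walks of length `m` in `Y` from `w` to a vertex of `T`. -/
def numWalks (Y : SimpleGraph W) [DecidableRel Y.Adj] (m : ℕ) (w : W) (T : Finset W) : ℕ :=
  ∑ u ∈ T, Fintype.card {p : Y.Walk w u | p.length = m}

end Matrices

end MarkedWalk

end

/-! The averaged probability is computed exactly, and both bounds are then Cauchy-Schwarz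
inequalities whose defects are written out.

On an arc function α(tail) + β(head), `U` acts by an explicit vertex formula (`transition_mulVec`),
which yields eigenvectors of `U` from vectors on the vertices. If z is a μ-eigenvector of A(X\a),
extended by 0 at a, and c is a unit complex number with real part μ/k, then z(head) - c̄ z(tail) has
eigenvalue c. If (Qh)(v) = 0 for all v ≠ a, then h(tail) + h(head) has eigenvalue -1. Put g_μ = G_μ
1_{N(a)} and p = (Q\a)⁻¹ 1_{N(a)}. The start state is a sum of such vectors (`sum_component`), built
from the g_μ and from h = e_a - p. Since |μ| < k, the phases are distinct, so cross terms average
out (`tendsto_average_norm_sq`) and the limit is the sum over w in N(a) of (1 - p(w))²/(4k) + Σ_μ k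
g_μ(w)²/(2(k² - μ²)²), which is `returnValue`.

For the lower bound, Cauchy-Schwarz is applied to w ↦ g_μ(w) and w ↦ 1 - p(w) on the k elements of
N(a). The sum of 1 - p over N(a) is the Schur complement of Q\a in Q: it is 0 for bipartite X and
1/Q⁻¹_{a,a} otherwise. Equality means that every g_μ is constant on N(a), which linear independence
of the sequences μ^m translates into walk counts (`numWalks_eq_iff`).

For the upper bound, g_μ(w), p(w) and 1 are the row sums over N(a) of G_μ, (Q\a)⁻¹ and (L\a)⁻¹, and
Cauchy-Schwarz is applied to each row (`upperBound_sub_returnValue`). Equality makes the rows of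
every G_μ, hence of their sum I, constant on N(a), so k = 1. -/

namespace MarkedWalk

/-! ### Spectral calculus for a real symmetric matrix -/

section Spectral

variable {W : Type*} [Fintype W] [DecidableEq W] {A : Matrix W W ℝ}

theorem toEuclideanCLM_eigproj (A : Matrix W W ℝ) (μ : ℝ) :
    Matrix.toEuclideanCLM (n := W) (𝕜 := ℝ) (eigproj A μ) =
      (Module.End.eigenspace (Matrix.toEuclideanLin A) μ).starProjection := by
  simp [eigproj]

theorem mul_eigproj (A : Matrix W W ℝ) (μ : ℝ) : A * eigproj A μ = μ • eigproj A μ := by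
  apply EquivLike.injective (Matrix.toEuclideanCLM (n := W) (𝕜 := ℝ))
  rw [map_mul, map_smul, toEuclideanCLM_eigproj]
  ext1 x
  have h := Submodule.starProjection_apply_mem
    (Module.End.eigenspace (Matrix.toEuclideanLin A) μ) x
  rw [Module.End.mem_eigenspace_iff] at h
  exact h

theorem eigproj_isSymm (A : Matrix W W ℝ) (μ : ℝ) : (eigproj A μ).IsSymm := by
  have h : IsSelfAdjoint (eigproj A μ) := by
    have := isSelfAdjoint_starProjection (Module.End.eigenspace (Matrix.toEuclideanLin A) μ)
    rw [← toEuclideanCLM_eigproj, isSelfAdjoint_iff, ← map_star] at this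
    exact EquivLike.injective (Matrix.toEuclideanCLM (n := W) (𝕜 := ℝ)) this
  simpa [isSelfAdjoint_iff, Matrix.star_eq_conjTranspose, Matrix.IsSymm] using h

theorem eigproj_mul (hA : A.IsSymm) (μ : ℝ) : eigproj A μ * A = μ • eigproj A μ := by
  have h := congrArg Matrix.transpose (mul_eigproj A μ)
  rwa [Matrix.transpose_mul, Matrix.transpose_smul, hA.eq, (eigproj_isSymm A μ).eq] at h

theorem mem_eigvals {μ : ℝ} :
    μ ∈ eigvals A ↔ Module.End.HasEigenvalue (Matrix.toEuclideanLin A) μ := by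
  rw [eigvals, Set.Finite.mem_toFinset, Module.End.hasEigenvalue_iff_mem_spectrum,
    ← Matrix.spectrum_toLpLin 2]

theorem exists_mulVec_eq_smul {μ : ℝ} (hμ : μ ∈ eigvals A) :
    ∃ z : W → ℝ, z ≠ 0 ∧ A *ᵥ z = μ • z := by
  obtain ⟨z, hz, h0⟩ := (mem_eigvals.1 hμ).exists_hasEigenvector
  refine ⟨z.ofLp, fun h => h0 (by ext i; exact congrFun h i), ?_⟩
  rw [Module.End.mem_eigenspace_iff] at hz
  exact congrArg WithLp.ofLp hz

/-- The eigenspaces of a symmetric operator span the space, so it suffices to test on one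
eigenvector, which orthogonality makes invisible to all projections but its own. -/
theorem sum_eigproj (hA : A.IsSymm) : ∑ μ ∈ eigvals A, eigproj A μ = 1 := by
  have hT : (Matrix.toEuclideanLin A).IsSymmetric :=
    Matrix.isSymmetric_toEuclideanLin_iff.2 (by simpa [Matrix.IsHermitian] using hA.eq)
  apply EquivLike.injective (Matrix.toEuclideanCLM (n := W) (𝕜 := ℝ))
  rw [map_sum, map_one]
  simp only [toEuclideanCLM_eigproj]
  ext1 x
  have htop : ⨆ μ : ℝ, Module.End.eigenspace (Matrix.toEuclideanLin A) μ = ⊤ :=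
    Submodule.orthogonal_eq_bot_iff.1 hT.orthogonalComplement_iSup_eigenspaces_eq_bot
  have hx : x ∈ ⨆ μ : ℝ, Module.End.eigenspace (Matrix.toEuclideanLin A) μ := htop ▸ trivial
  rw [sum_apply, one_apply_eq_self]
  induction hx using Submodule.iSup_induction' with
  | zero => simp
  | add y z _ _ hy hz => rw [← Finset.sum_congr rfl fun μ _ => (map_add _ y z).symm,
      Finset.sum_add_distrib, hy, hz]
  | mem ν y hy =>
    by_cases h0 : y = 0
    · simp [h0]
    have hν : ν ∈ eigvals A := mem_eigvals.2 (Module.End.hasEigenvalue_of_hasEigenvector ⟨hy, h0⟩)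
    rw [Finset.sum_eq_single_of_mem ν hν, Submodule.starProjection_eq_self_iff.2 hy]
    intro μ _ hne
    rw [Submodule.starProjection_apply_eq_zero_iff, Submodule.mem_orthogonal]
    intro u hu
    exact hT.orthogonalFamily_eigenspaces hne ⟨u, hu⟩ ⟨y, hy⟩

theorem pow_eq_sum_eigproj (hA : A.IsSymm) (m : ℕ) :
    A ^ m = ∑ μ ∈ eigvals A, μ ^ m • eigproj A μ := by
  induction m with
  | zero => simp [sum_eigproj hA]
  | succ m ih =>
    rw [pow_succ', ih, Finset.mul_sum]
    refine Finset.sum_congr rfl fun μ _ => ?_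
    rw [Matrix.mul_smul, mul_eigproj, smul_smul, pow_succ]

theorem smul_one_add_smul_mul_sum_eigproj
    (hA : A.IsSymm) (a b : ℝ) (h : ∀ μ ∈ eigvals A, a + b * μ ≠ 0) :
    (a • 1 + b • A) * ∑ μ ∈ eigvals A, (a + b * μ)⁻¹ • eigproj A μ = 1 := by
  rw [Finset.mul_sum, ← sum_eigproj hA]
  refine Finset.sum_congr rfl fun μ hμ => ?_
  rw [Matrix.mul_smul, add_mul, Matrix.smul_mul, Matrix.smul_mul, sum_eigproj hA, one_mul,
    mul_eigproj, smul_smul, ← add_smul, smul_smul, inv_mul_cancel₀ (h μ hμ), one_smul]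

/-- The resolvent-type expansion of the inverse of `a I + b A`. -/
theorem inv_eq_sum_eigproj (hA : A.IsSymm) (a b : ℝ) (h : ∀ μ ∈ eigvals A, a + b * μ ≠ 0) :
    (a • 1 + b • A)⁻¹ = ∑ μ ∈ eigvals A, (a + b * μ)⁻¹ • eigproj A μ :=
  Matrix.inv_eq_right_inv (smul_one_add_smul_mul_sum_eigproj hA a b h)

theorem inv_mul_eigproj (a b : ℝ) (h : ∀ μ ∈ eigvals A, a + b * μ ≠ 0)
    (hu : IsUnit (a • 1 + b • A)) {μ : ℝ} (hμ : μ ∈ eigvals A) :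
    (a • 1 + b • A)⁻¹ * eigproj A μ = (a + b * μ)⁻¹ • eigproj A μ := by
  have e : (a • 1 + b • A) * eigproj A μ = (a + b * μ) • eigproj A μ := by
    rw [add_mul, Matrix.smul_mul, Matrix.smul_mul, one_mul, mul_eigproj, smul_smul, ← add_smul]
  have e2 : (a • 1 + b • A)⁻¹ * ((a • 1 + b • A) * eigproj A μ) = eigproj A μ := by
    rw [← mul_assoc, Matrix.nonsing_inv_mul _ ((Matrix.isUnit_iff_isUnit_det _).1 hu), one_mul]
  rw [e, Matrix.mul_smul] at e2
  rw [eq_inv_smul_iff₀ (h μ hμ), e2]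

theorem eigproj_mul_inv (hA : A.IsSymm) (a b : ℝ) (h : ∀ μ ∈ eigvals A, a + b * μ ≠ 0)
    (hu : IsUnit (a • 1 + b • A)) {μ : ℝ} (hμ : μ ∈ eigvals A) :
    eigproj A μ * (a • 1 + b • A)⁻¹ = (a + b * μ)⁻¹ • eigproj A μ := by
  have e := congrArg Matrix.transpose (inv_mul_eigproj a b h hu hμ)
  rwa [Matrix.transpose_mul, Matrix.transpose_smul, (eigproj_isSymm A μ).eq,
    Matrix.transpose_nonsing_inv, Matrix.transpose_add, Matrix.transpose_smul,
    Matrix.transpose_smul, hA.eq, Matrix.transpose_one] at e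

end Spectral

/-! ### Independence of power sequences, and the Cauchy-Schwarz defect -/

section Sums

/-- Distinct exponentials are linearly independent. -/
theorem forall_eq_zero_of_sum_pow_mul_eq_zero (s : Finset ℝ) (d : ℝ → ℝ)
    (h : ∀ m : ℕ, ∑ μ ∈ s, μ ^ m * d μ = 0) : ∀ μ ∈ s, d μ = 0 := by
  have hp (P : Polynomial ℝ) : ∑ μ ∈ s, P.eval μ * d μ = 0 := by
    simp only [Polynomial.eval_eq_sum_range, Finset.sum_mul]
    rw [Finset.sum_comm]
    refine Finset.sum_eq_zero fun m _ => ?_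
    simp only [mul_assoc, ← Finset.mul_sum, h m, mul_zero]
  intro μ hμ
  -- The hypothesis extends linearly from powers to all polynomials; the Lagrange basis polynomial
  -- at μ isolates `d μ`.
  have := hp (Lagrange.basis s id μ)
  rw [Finset.sum_eq_single_of_mem μ hμ] at this
  · have e := Lagrange.eval_basis_self (v := id) (Set.injOn_id (s : Set ℝ)) hμ
    rw [id_eq] at e
    rwa [e, one_mul] at this
  · intro ν hν hne
    have := Lagrange.eval_basis_of_ne (v := id) (Ne.symm hne) hν
    rw [id_eq] at this
    rw [this, zero_mul]

/-- The Lagrange form of the Cauchy-Schwarz inequality against a constant vector. -/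
theorem card_mul_sum_sq_sub_sq_sum {ι : Type*} (s : Finset ι) (y : ι → ℝ) :
    s.card * ∑ i ∈ s, y i ^ 2 - (∑ i ∈ s, y i) ^ 2 =
      1 / 2 * ∑ i ∈ s, ∑ j ∈ s, (y i - y j) ^ 2 := by
  have h (i j : ι) : (y i - y j) ^ 2 = y i ^ 2 - 2 * (y i * y j) + y j ^ 2 := by ring
  simp only [h, Finset.sum_add_distrib, Finset.sum_sub_distrib, Finset.sum_const, nsmul_eq_mul,
    ← Finset.mul_sum, ← Finset.sum_mul]
  ring

theorem sq_sum_eq_card_mul_sum_sq_iff {ι : Type*} (s : Finset ι) (y : ι → ℝ) :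
    s.card * ∑ i ∈ s, y i ^ 2 - (∑ i ∈ s, y i) ^ 2 = 0 ↔ ∀ i ∈ s, ∀ j ∈ s, y i = y j := by
  rw [card_mul_sum_sq_sub_sq_sum, mul_eq_zero_iff_left (by norm_num),
    Finset.sum_eq_zero_iff_of_nonneg fun i _ => Finset.sum_nonneg fun j _ => sq_nonneg _]
  refine forall₂_congr fun i _ => ?_
  rw [Finset.sum_eq_zero_iff_of_nonneg fun j _ => sq_nonneg _]
  simp [sub_eq_zero]

theorem card_mul_sum_sq_sub_sq_sum_nonneg {ι : Type*} (s : Finset ι) (y : ι → ℝ) :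
    0 ≤ s.card * ∑ i ∈ s, y i ^ 2 - (∑ i ∈ s, y i) ^ 2 := by
  linarith [sq_sum_le_card_mul_sum_sq (s := s) (f := y)]

end Sums

/-! ### Time averages of unimodular exponentials -/

section Average

/-- For z ≠ 1 the geometric sums stay bounded by 2/|z - 1|, so division by T sends them to 0. -/
theorem tendsto_average_pow {z : ℂ} (hz : ‖z‖ = 1) :
    Tendsto (fun T : ℕ => (1 / (T : ℂ)) * ∑ t ∈ Finset.range T, z ^ t) atTop
      (𝓝 (if z = 1 then 1 else 0)) := by
  split_ifs with h
  · refine tendsto_const_nhds.congr' ?_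
    filter_upwards [eventually_ne_atTop 0] with T hT
    have : (T : ℂ) ≠ 0 := by exact_mod_cast hT
    simp [h, this]
  · have hb : ∀ T : ℕ, ‖(1 / (T : ℂ)) * ∑ t ∈ Finset.range T, z ^ t‖ ≤ (2 / ‖z - 1‖) / T := by
      intro T
      rw [geom_sum_eq h, norm_mul, norm_div, norm_div, norm_one, Complex.norm_natCast]
      have : ‖z ^ T - 1‖ ≤ 2 := by
        calc ‖z ^ T - 1‖ ≤ ‖z ^ T‖ + ‖(1 : ℂ)‖ := norm_sub_le _ _
          _ = 2 := by rw [norm_pow, hz]; norm_num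
      calc 1 / (T : ℝ) * (‖z ^ T - 1‖ / ‖z - 1‖) ≤ 1 / (T : ℝ) * (2 / ‖z - 1‖) := by gcongr
        _ = _ := by ring
    exact squeeze_zero_norm hb (tendsto_const_div_atTop_nhds_zero_nat _)

/-- The time average of the squared modulus of a sum of distinct unimodular exponentials. -/
theorem tendsto_average_norm_sq {ι : Type*} [Fintype ι] (θ b : ι → ℂ) (hθ : ∀ i, ‖θ i‖ = 1)
    (hinj : Function.Injective θ) :
    Tendsto (fun T : ℕ => 1 / (T : ℝ) * ∑ t ∈ Finset.range T, ‖∑ i, θ i ^ t * b i‖ ^ 2) atTop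
      (𝓝 (∑ i, ‖b i‖ ^ 2)) := by
  classical
  have hconj (j : ι) : θ j * starRingEnd ℂ (θ j) = 1 := by
    rw [Complex.mul_conj, Complex.normSq_eq_norm_sq, hθ]; norm_num
  -- The squared modulus is expanded as a double sum; the (i, j) term has ratio θ_i θ̄_j, which
  -- equals 1 only when i = j, by injectivity.
  have key : Tendsto (fun T : ℕ => ∑ i, ∑ j, (b i * starRingEnd ℂ (b j)) *
      ((1 / (T : ℂ)) * ∑ t ∈ Finset.range T, (θ i * starRingEnd ℂ (θ j)) ^ t)) atTop
      (𝓝 (∑ i, ∑ j, (b i * starRingEnd ℂ (b j)) *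
        (if θ i * starRingEnd ℂ (θ j) = 1 then 1 else 0))) := by
    refine tendsto_finsetSum _ fun i _ => tendsto_finsetSum _ fun j _ => Tendsto.const_mul _ ?_
    apply tendsto_average_pow
    rw [norm_mul, RCLike.norm_conj, hθ, hθ, one_mul]
  have hlim : (∑ i, ∑ j, (b i * starRingEnd ℂ (b j)) *
        (if θ i * starRingEnd ℂ (θ j) = 1 then 1 else 0)) = ((∑ i, ‖b i‖ ^ 2 : ℝ) : ℂ) := by
    push_cast
    refine Finset.sum_congr rfl fun i _ => ?_
    rw [Finset.sum_eq_single i]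
    · rw [if_pos (hconj i), mul_one, Complex.mul_conj, Complex.normSq_eq_norm_sq]
      push_cast; rfl
    · intro j _ hj
      rw [if_neg, mul_zero]
      intro h
      have h0 : starRingEnd ℂ (θ j) ≠ 0 := fun h => by simpa [h] using hconj j
      exact hj (hinj (mul_right_cancel₀ h0 ((hconj j).trans h.symm)))
    · simp
  rw [hlim] at key
  have := (Complex.continuous_re.tendsto _).comp key
  rw [Complex.ofReal_re] at this
  refine this.congr fun T => ?_
  have e : ∑ i, ∑ j, (b i * starRingEnd ℂ (b j)) *
      ((1 / (T : ℂ)) * ∑ t ∈ Finset.range T, (θ i * starRingEnd ℂ (θ j)) ^ t) =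
      ((1 / (T : ℝ) * ∑ t ∈ Finset.range T, ‖∑ i, θ i ^ t * b i‖ ^ 2 : ℝ) : ℂ) := by
    push_cast
    have (t : ℕ) : ((‖∑ i, θ i ^ t * b i‖ : ℂ)) ^ 2 =
        ∑ i, ∑ j, (b i * starRingEnd ℂ (b j)) * (θ i * starRingEnd ℂ (θ j)) ^ t := by
      rw [← Complex.mul_conj', map_sum (starRingEnd ℂ), Finset.sum_mul_sum]
      refine Finset.sum_congr rfl fun i _ => Finset.sum_congr rfl fun j _ => ?_
      rw [map_mul, map_pow, mul_pow]; ring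
    simp only [this]
    symm
    rw [Finset.sum_comm, Finset.mul_sum]
    refine Finset.sum_congr rfl fun i _ => ?_
    rw [Finset.sum_comm, Finset.mul_sum]
    refine Finset.sum_congr rfl fun j _ => ?_
    rw [← Finset.mul_sum]; ring
  simp only [Function.comp_apply, e, Complex.ofReal_re]

theorem pow_mulVec_sum {n ι : Type*} [Fintype n] [DecidableEq n] [Fintype ι]
    (U : Matrix n n ℂ) (θ : ι → ℂ) (v : ι → n → ℂ) (h : ∀ i, U *ᵥ v i = θ i • v i) (t : ℕ) :
    (U ^ t) *ᵥ (∑ i, v i) = ∑ i, θ i ^ t • v i := by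
  induction t with
  | zero => simp
  | succ t ih =>
    rw [pow_succ', ← Matrix.mulVec_mulVec, ih, Matrix.mulVec_sum]
    refine Finset.sum_congr rfl fun i _ => ?_
    rw [Matrix.mulVec_smul, h, smul_smul, pow_succ]

end Average

end MarkedWalk

namespace MarkedWalk

theorem isUnit_smul_one_add_smul {W : Type*} [Fintype W] [DecidableEq W]
    {A : Matrix W W ℝ} (hA : A.IsSymm) (a b : ℝ) (h : ∀ μ ∈ eigvals A, a + b * μ ≠ 0) :
    IsUnit (a • 1 + b • A) := by
  rw [Matrix.isUnit_iff_isUnit_det]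
  exact Matrix.isUnit_det_of_right_inverse (smul_one_add_smul_mul_sum_eigproj hA a b h)

/-! ### The neighborhood of a, quadratic forms of L and Q, and bipartiteness -/

section Graph

variable {V : Type*} [Fintype V] [DecidableEq V] (X : SimpleGraph V) [DecidableRel X.Adj]
  (a : V)

theorem sum_eq_add_sum_ne {M : Type*} [AddCommMonoid M] (f : V → M) :
    ∑ v, f v = f a + ∑ w : {v : V // v ≠ a}, f w := by
  rw [← Finset.add_sum_erase _ f (Finset.mem_univ a)]
  congr 1
  exact Finset.sum_subtype _ (by simp) f

/-- The indicator vector of the neighborhood of the deleted vertex. -/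
def nbrInd : {v : V // v ≠ a} → ℝ := fun w => if w ∈ nbrs X a then 1 else 0

variable {X a}

theorem mem_nbrs {w : {v : V // v ≠ a}} : w ∈ nbrs X a ↔ X.Adj a w := by simp [nbrs]

theorem nbrInd_apply (w : {v : V // v ≠ a}) : nbrInd X a w = if X.Adj a w then 1 else 0 := by
  simp [nbrInd, mem_nbrs]

theorem mulVec_nbrInd (M : Matrix {v : V // v ≠ a} {v : V // v ≠ a} ℝ) (w : {v : V // v ≠ a}) :
    (M *ᵥ nbrInd X a) w = ∑ u ∈ nbrs X a, M w u := by
  simp [Matrix.mulVec, dotProduct, nbrInd, Finset.sum_ite_mem]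

theorem elsm_nbrs (M : Matrix {v : V // v ≠ a} {v : V // v ≠ a} ℝ) :
    elsm (nbrs X a) M = ∑ w ∈ nbrs X a, (M *ᵥ nbrInd X a) w := by
  simp [elsm, mulVec_nbrInd]

theorem sum_adj_eq_sum_nbrs {M : Type*} [AddCommMonoid M] (f : V → M) :
    ∑ v, (if X.Adj a v then f v else 0) = ∑ w ∈ nbrs X a, f w := by
  rw [sum_eq_add_sum_ne a, if_neg (X.loopless.irrefl a), zero_add, nbrs, Finset.sum_filter]

theorem card_nbrs {k : ℕ} (hreg : X.IsRegularOfDegree k) : (nbrs X a).card = k := by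
  have := sum_adj_eq_sum_nbrs (X := X) (a := a) (fun _ => 1)
  rw [← hreg a, SimpleGraph.degree, SimpleGraph.neighborFinset_eq_filter, Finset.card_eq_sum_ones,
    Finset.card_eq_sum_ones, ← this, Finset.sum_filter]

theorem sum_adj_ne {R : Type*} [NonAssocSemiring R] (z : V → R) (w : {v : V // v ≠ a}) :
    ∑ v, (if X.Adj w v then z v else 0) = (if X.Adj a w then z a else 0) +
      ∑ u, (if (deleteVertex X a).Adj w u then z u else 0) := by
  rw [sum_eq_add_sum_ne a]
  simp [X.adj_comm a w]

omit [DecidableEq V] in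
theorem adjMatrix_mulVec_sum (Y : SimpleGraph V) [DecidableRel Y.Adj] (z : V → ℝ) (w : V) :
    (Y.adjMatrix ℝ *ᵥ z) w = ∑ u, (if Y.Adj w u then z u else 0) := by
  simp [Matrix.mulVec, dotProduct, SimpleGraph.adjMatrix_apply, ite_mul]

theorem adjMatrix_mulVec_ne (z : V → ℝ) (w : {v : V // v ≠ a}) :
    (X.adjMatrix ℝ *ᵥ z) w = nbrInd X a w * z a +
      ((deleteVertex X a).adjMatrix ℝ *ᵥ fun u => z u) w := by
  rw [adjMatrix_mulVec_sum, adjMatrix_mulVec_sum, sum_adj_ne, nbrInd_apply, ite_mul, one_mul,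
    zero_mul]

theorem adjMatrix_mulVec_self (z : V → ℝ) :
    (X.adjMatrix ℝ *ᵥ z) a = ∑ w ∈ nbrs X a, z w := by
  rw [adjMatrix_mulVec_sum, sum_adj_eq_sum_nbrs]

theorem degMatrix_eq {k : ℕ} (hreg : X.IsRegularOfDegree k) :
    X.degMatrix ℝ = (k : ℝ) • 1 := by
  ext i j
  simp [SimpleGraph.degMatrix, Matrix.diagonal_apply, Matrix.one_apply, hreg.degree_eq]

theorem minorAt_lapMatrix {k : ℕ} (hreg : X.IsRegularOfDegree k) :
    minorAt a (X.lapMatrix ℝ) = (k : ℝ) • 1 + (-1 : ℝ) • (deleteVertex X a).adjMatrix ℝ := by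
  ext i j
  simp [minorAt, SimpleGraph.lapMatrix, degMatrix_eq hreg, Matrix.one_apply, Subtype.ext_iff,
    sub_eq_add_neg, SimpleGraph.adjMatrix_apply]

theorem minorAt_signlessLap {k : ℕ} (hreg : X.IsRegularOfDegree k) :
    minorAt a (signlessLap X) = (k : ℝ) • 1 + (1 : ℝ) • (deleteVertex X a).adjMatrix ℝ := by
  ext i j
  simp [minorAt, signlessLap, degMatrix_eq hreg, Matrix.one_apply, Subtype.ext_iff,
    SimpleGraph.adjMatrix_apply]

theorem signlessLap_mulVec {k : ℕ} (hreg : X.IsRegularOfDegree k) (z : V → ℝ) (v : V) :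
    (signlessLap X *ᵥ z) v = k * z v + (X.adjMatrix ℝ *ᵥ z) v := by
  simp [signlessLap, degMatrix_eq hreg, Matrix.add_mulVec, Matrix.smul_mulVec]

-- The cases ε = 1 and ε = -1 are the quadratic forms of Q and L, treated together. The factor 2
-- appears because each edge is counted in both directions.
omit [DecidableEq V] in
theorem sum_sum_adj_sq {k : ℕ} (hreg : X.IsRegularOfDegree k) {ε : ℝ} (hε : ε ^ 2 = 1)
    (z : V → ℝ) :
    ∑ i, ∑ j, (if X.Adj i j then (z i + ε * z j) ^ 2 else 0) =
      2 * ∑ i, z i * (k * z i + ε * (X.adjMatrix ℝ *ᵥ z) i) := by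
  have hdeg (i : V) : (∑ j, if X.Adj i j then (1 : ℝ) else 0) = k := by
    rw [← SimpleGraph.degree_eq_sum_if_adj, hreg i]
  have e1 (i j : V) : (if X.Adj i j then (z i + ε * z j) ^ 2 else 0) =
      z i ^ 2 * (if X.Adj i j then 1 else 0) + 2 * ε * z i * (if X.Adj i j then z j else 0) +
        z j ^ 2 * (if X.Adj j i then 1 else 0) := by
    simp only [X.adj_comm j i]
    split_ifs
    · linear_combination z j ^ 2 * hε
    · ring
  simp only [e1, Finset.sum_add_distrib]
  rw [Finset.sum_comm (f := fun i j => z j ^ 2 * (if X.Adj j i then (1 : ℝ) else 0))]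
  simp only [← Finset.mul_sum, hdeg, adjMatrix_mulVec_sum]
  rw [Finset.mul_sum, ← Finset.sum_add_distrib, ← Finset.sum_add_distrib]
  refine Finset.sum_congr rfl fun i _ => ?_
  ring

-- Every edge term vanishes, so |z| is preserved along edges, and connectedness spreads this along
-- walks.
omit [DecidableEq V] in
theorem abs_eq_of_sum_sum_adj_sq_eq_zero (hconn : X.Connected) {ε : ℝ} (hε : ε ^ 2 = 1)
    {z : V → ℝ} (h : ∑ i, ∑ j, (if X.Adj i j then (z i + ε * z j) ^ 2 else 0) = 0) :
    (∀ i j, X.Adj i j → z i = -(ε * z j)) ∧ ∀ i j, |z i| = |z j| := by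
  have hadj : ∀ i j, X.Adj i j → z i = -(ε * z j) := by
    intro i j hij
    rw [Finset.sum_eq_zero_iff_of_nonneg fun i _ => Finset.sum_nonneg fun j _ => by
      split_ifs <;> positivity] at h
    have h2 := h i (Finset.mem_univ _)
    rw [Finset.sum_eq_zero_iff_of_nonneg fun j _ => by split_ifs <;> positivity] at h2
    have h3 := h2 j (Finset.mem_univ _)
    rw [if_pos hij] at h3
    exact eq_neg_of_add_eq_zero_left (pow_eq_zero_iff two_ne_zero |>.1 h3)
  refine ⟨hadj, fun i j => ?_⟩
  have hε' : |ε| = 1 := by rw [← sq_eq_sq₀ (abs_nonneg _) zero_le_one, sq_abs, hε, one_pow]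
  obtain ⟨p⟩ := hconn.preconnected i j
  induction p with
  | nil => rfl
  | cons hA _ ih => rw [hadj _ _ hA, abs_neg, abs_mul, hε', one_mul, ih]

/-- Extended by zero at a, an eigenvector z has form value 2(k + εμ)‖z‖² ≥ 0. If this were 0, the
extension would have constant modulus while vanishing at a, forcing z = 0. -/
theorem add_mul_eigval_pos {k : ℕ} (hconn : X.Connected) (hreg : X.IsRegularOfDegree k) {ε : ℝ}
    (hε : ε ^ 2 = 1) {μ : ℝ} (hμ : μ ∈ eigvals ((deleteVertex X a).adjMatrix ℝ)) :
    0 < (k : ℝ) + ε * μ := by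
  obtain ⟨z, hz0, hz⟩ := exists_mulVec_eq_smul hμ
  let y : V → ℝ := fun v => if h : v ≠ a then z ⟨v, h⟩ else 0
  have hya : y a = 0 := by simp [y]
  have hyw (w : {v : V // v ≠ a}) : y w = z w := by simp [y, w.2]
  have hq := sum_sum_adj_sq hreg hε y
  have hz' (w) : ((deleteVertex X a).adjMatrix ℝ *ᵥ z) w = μ * z w := by rw [hz]; rfl
  have e : ∑ i, y i * (k * y i + ε * (X.adjMatrix ℝ *ᵥ y) i) =
      (k + ε * μ) * ∑ w, z w ^ 2 := by
    rw [sum_eq_add_sum_ne a, hya, zero_mul, zero_add, Finset.mul_sum]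
    refine Finset.sum_congr rfl fun w _ => ?_
    rw [adjMatrix_mulVec_ne, hya]
    simp only [hyw, hz']
    ring
  rw [e] at hq
  have hpos : 0 < ∑ w, z w ^ 2 := by
    obtain ⟨w, hw⟩ := Function.ne_iff.1 hz0
    exact Finset.sum_pos' (fun _ _ => sq_nonneg _) ⟨w, Finset.mem_univ _, by
      have : z w ≠ 0 := hw
      positivity⟩
  have hnn : 0 ≤ ∑ i, ∑ j, (if X.Adj i j then (y i + ε * y j) ^ 2 else 0) :=
    Finset.sum_nonneg fun i _ => Finset.sum_nonneg fun j _ => by split_ifs <;> positivity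
  rcases hnn.eq_or_lt with h0 | h0
  · exfalso
    have h := (abs_eq_of_sum_sum_adj_sq_eq_zero hconn hε h0.symm).2
    apply hz0
    funext w
    have := h w a
    rwa [hya, abs_zero, abs_eq_zero, hyw] at this
  · rw [hq] at h0
    have h1 : 0 < (k + ε * μ) * ∑ w, z w ^ 2 := by linarith
    exact pos_of_mul_pos_left h1 hpos.le

theorem abs_eigval_lt {k : ℕ} (hconn : X.Connected) (hreg : X.IsRegularOfDegree k) {μ : ℝ}
    (hμ : μ ∈ eigvals ((deleteVertex X a).adjMatrix ℝ)) : |μ| < k := by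
  have h1 := add_mul_eigval_pos hconn hreg (ε := 1) (by norm_num) hμ
  have h2 := add_mul_eigval_pos hconn hreg (ε := -1) (by norm_num) hμ
  exact abs_lt.2 ⟨by linarith, by linarith⟩

/-- Rows of L sum to zero, so removing column a leaves minus that column. This is the source of
every identity in which (L\a)⁻¹ produces the constant 1. -/
theorem minorAt_lapMatrix_mulVec_one {k : ℕ} (hreg : X.IsRegularOfDegree k) :
    minorAt a (X.lapMatrix ℝ) *ᵥ (fun _ => 1) = nbrInd X a := by
  funext w
  have h := adjMatrix_mulVec_ne (X := X) (a := a) (fun _ => (1 : ℝ)) w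
  rw [adjMatrix_mulVec_sum, ← SimpleGraph.degree_eq_sum_if_adj, hreg.degree_eq] at h
  rw [minorAt_lapMatrix hreg, Matrix.add_mulVec, Matrix.smul_mulVec, Matrix.smul_mulVec,
    Matrix.one_mulVec]
  simp only [Pi.add_apply, Pi.smul_apply, smul_eq_mul]
  linarith

/-- A kernel vector of Q changes sign across each edge and vanishes nowhere, so its sign is a proper
2-coloring. -/
theorem isBipartite_of_signlessLap_mulVec_eq_zero {k : ℕ} (hconn : X.Connected)
    (hreg : X.IsRegularOfDegree k) {h : V → ℝ} (h0 : h ≠ 0) (hQ : signlessLap X *ᵥ h = 0) :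
    X.IsBipartite := by
  have hq := sum_sum_adj_sq hreg (ε := 1) (by norm_num) h
  have e : ∑ i, h i * (k * h i + 1 * (X.adjMatrix ℝ *ᵥ h) i) = 0 := by
    refine Finset.sum_eq_zero fun i _ => ?_
    rw [one_mul, ← signlessLap_mulVec hreg, hQ]; simp
  rw [e, mul_zero] at hq
  obtain ⟨h1, h2⟩ := abs_eq_of_sum_sum_adj_sq_eq_zero hconn (by norm_num) hq
  obtain ⟨v, hv⟩ := Function.ne_iff.1 h0
  have hne (i : V) : h i ≠ 0 := by
    rw [← abs_pos, h2 i v, abs_pos]; exact hv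
  have C : X.Coloring Bool := SimpleGraph.Coloring.mk (fun v => decide (0 < h v)) (by
    intro i j hij
    have := h1 i j hij
    have := hne i
    have := hne j
    rcases lt_or_gt_of_ne this with hj | hj
    · have hi : 0 < h i := by linarith
      simp [hi, hj.le]
    · have hi : h i < 0 := by linarith
      simp [hi.le, hj])
  simpa using C.colorable

theorem isUnit_signlessLap {k : ℕ} (hconn : X.Connected)
    (hreg : X.IsRegularOfDegree k) (hb : ¬ X.IsBipartite) : IsUnit (signlessLap X) := by
  rw [Matrix.isUnit_iff_isUnit_det, isUnit_iff_ne_zero]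
  intro hdet
  obtain ⟨h, h0, hQ⟩ := Matrix.exists_mulVec_eq_zero_iff.2 hdet
  exact hb (isBipartite_of_signlessLap_mulVec_eq_zero hconn hreg h0 hQ)

/-- On a neighborhood in a bipartite graph, the inverses of the Laplacian minor and the signless
Laplacian minor agree. -/
theorem signlessLap_inv_eq_lap_inv_of_isBipartite {k : ℕ} (hreg : X.IsRegularOfDegree k)
    (hu : IsUnit (minorAt a (X.lapMatrix ℝ))) (hb : X.IsBipartite) {u w : {v : V // v ≠ a}}
    (hu' : u ∈ nbrs X a) (hw' : w ∈ nbrs X a) :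
    (minorAt a (signlessLap X))⁻¹ u w = (minorAt a (X.lapMatrix ℝ))⁻¹ u w := by
  obtain ⟨C⟩ := hb
  -- The ±1 signs of the bipartition conjugate L\a into Q\a.
  let s : V → ℝ := fun v => if C v = 0 then 1 else -1
  have hs2 (v : V) : s v * s v = 1 := by simp only [s]; split_ifs <;> norm_num
  have hs (i j : V) (hij : X.Adj i j) : s i = - s j := by
    have h := C.valid hij
    simp only [s]
    generalize C i = c at h
    generalize C j = d at h
    fin_cases c <;> fin_cases d <;> simp_all
  let S : Matrix {v : V // v ≠ a} {v : V // v ≠ a} ℝ := Matrix.diagonal fun w => s w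
  have hSS : S * S = 1 := by simp [S, hs2]
  have hQ : minorAt a (signlessLap X) = S * minorAt a (X.lapMatrix ℝ) * S := by
    rw [minorAt_signlessLap hreg, minorAt_lapMatrix hreg]
    ext i j
    rw [Matrix.mul_diagonal, Matrix.diagonal_mul]
    simp only [Matrix.add_apply, Matrix.smul_apply, Matrix.one_apply, SimpleGraph.adjMatrix_apply,
      smul_eq_mul, SimpleGraph.comap_adj]
    by_cases hij : i = j
    · subst hij
      have := hs2 i
      simp only [if_true, mul_one, SimpleGraph.irrefl, if_false, mul_zero, add_zero]
      linear_combination -(k : ℝ) * this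
    · rw [if_neg hij]
      by_cases h : X.Adj i j
      · rw [if_pos h, hs _ _ h]
        linear_combination - hs2 j
      · rw [if_neg h]; ring
  have hinv : (minorAt a (signlessLap X))⁻¹ = S * (minorAt a (X.lapMatrix ℝ))⁻¹ * S := by
    apply Matrix.inv_eq_right_inv
    rw [hQ]
    calc S * minorAt a (X.lapMatrix ℝ) * S * (S * (minorAt a (X.lapMatrix ℝ))⁻¹ * S)
        = S * (minorAt a (X.lapMatrix ℝ) * (S * S) * (minorAt a (X.lapMatrix ℝ))⁻¹) * S := by
          simp only [mul_assoc]
      _ = 1 := by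
          rw [hSS, mul_one, Matrix.mul_nonsing_inv _ ((Matrix.isUnit_iff_isUnit_det _).1 hu),
            mul_one, hSS]
  -- Two neighbors of a carry the same sign, opposite to that of a, so conjugation leaves this entry
  -- unchanged.
  rw [hinv, Matrix.mul_diagonal, Matrix.diagonal_mul, hs _ _ (mem_nbrs.1 hu').symm,
    hs _ _ (mem_nbrs.1 hw').symm]
  linear_combination (minorAt a (X.lapMatrix ℝ))⁻¹ u w * hs2 a

theorem walk_count_eq_pow_mulVec (m : ℕ) (w : {v : V // v ≠ a}) :
    (numWalks (deleteVertex X a) m w (nbrs X a) : ℝ) =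
      (((deleteVertex X a).adjMatrix ℝ) ^ m *ᵥ nbrInd X a) w := by
  rw [mulVec_nbrInd, numWalks]
  push_cast
  refine Finset.sum_congr rfl fun u _ => ?_
  rw [SimpleGraph.adjMatrix_pow_apply_eq_card_walk]

theorem nonempty_iso_top_fin_two_iff {k : ℕ} (hk : 0 < k) (hconn : X.Connected)
    (hreg : X.IsRegularOfDegree k) : Nonempty (X ≃g (⊤ : SimpleGraph (Fin 2))) ↔ k = 1 := by
  constructor
  · rintro ⟨f⟩
    obtain ⟨v⟩ := hconn.nonempty
    have := f.degree_eq v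
    rw [hreg v, SimpleGraph.complete_graph_degree, Fintype.card_fin] at this
    exact this.symm
  · rintro rfl
    obtain ⟨a⟩ := hconn.nonempty
    have hdeg (v : V) : (X.neighborFinset v).card = 1 := hreg v
    obtain ⟨b, hb⟩ := Finset.card_eq_one.1 (hdeg a)
    obtain ⟨c, hc⟩ := Finset.card_eq_one.1 (hdeg b)
    have hab : X.Adj a b := by rw [← SimpleGraph.mem_neighborFinset, hb]; simp
    obtain rfl : a = c := by
      have : a ∈ X.neighborFinset b := by rw [SimpleGraph.mem_neighborFinset]; exact hab.symm
      rwa [hc, Finset.mem_singleton] at this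
    have hb' (v) (h : X.Adj a v) : v = b := by
      rwa [← SimpleGraph.mem_neighborFinset, hb, Finset.mem_singleton] at h
    have hc' (v) (h : X.Adj b v) : v = a := by
      rwa [← SimpleGraph.mem_neighborFinset, hc, Finset.mem_singleton] at h
    -- In degree 1, a and b are adjacent only to each other, so no walk ending in {a, b} starts
    -- outside it.
    have hwalk (v w : V) (p : X.Walk v w) (hw : w = a ∨ w = b) : v = a ∨ v = b := by
      induction p with
      | nil => exact hw
      | cons hA _ ih =>
        rcases ih hw with rfl | rfl
        · exact .inr (hb' _ hA.symm)
        · exact .inl (hc' _ hA.symm)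
    have hall (v : V) : v = a ∨ v = b := by
      obtain ⟨p⟩ := hconn.preconnected v a
      exact hwalk v a p (.inl rfl)
    have htop : X = ⊤ := by
      ext u v
      rw [SimpleGraph.top_adj]
      refine ⟨fun h => h.ne, fun h => ?_⟩
      rcases hall u with rfl | rfl <;> rcases hall v with rfl | rfl
      · exact absurd rfl h
      · exact hab
      · exact hab.symm
      · exact absurd rfl h
    have hcard : Fintype.card V = 2 := by
      rw [← Finset.card_univ, ← Finset.card_pair hab.ne]
      congr 1
      ext v
      simpa using hall v
    rw [htop]
    exact ⟨SimpleGraph.Iso.completeGraph (Fintype.equivFinOfCardEq hcard)⟩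

end Graph

end MarkedWalk

noncomputable section

namespace MarkedWalk

/-! ### Unit complex numbers with prescribed real part -/

section Rotation

/-- The unit complex number with real part `s` lying in the upper or lower half plane. -/
def unitWithRe (s : ℝ) (b : Bool) : ℂ :=
  ⟨s, if b then Real.sqrt (1 - s ^ 2) else -Real.sqrt (1 - s ^ 2)⟩

variable {s : ℝ}

theorem one_sub_sq_pos (hs : |s| < 1) : 0 < 1 - s ^ 2 := by
  have := (sq_lt_one_iff_abs_lt_one s).2 hs
  linarith

theorem conj_mul_unitWithRe (hs : |s| < 1) (b : Bool) :
    starRingEnd ℂ (unitWithRe s b) * unitWithRe s b = 1 := by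
  have h := Real.mul_self_sqrt (one_sub_sq_pos hs).le
  apply Complex.ext
  · simp only [unitWithRe, Complex.mul_re, Complex.conj_re, Complex.conj_im, Complex.one_re]
    split_ifs <;> linear_combination h
  · simp only [unitWithRe, Complex.mul_im, Complex.conj_re, Complex.conj_im, Complex.one_im]
    ring

theorem norm_unitWithRe (hs : |s| < 1) (b : Bool) : ‖unitWithRe s b‖ = 1 := by
  have h := conj_mul_unitWithRe hs b
  rw [Complex.conj_mul', ← Complex.ofReal_pow, Complex.ofReal_eq_one] at h
  exact (pow_eq_one_iff_of_nonneg (norm_nonneg _) two_ne_zero).1 h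

theorem unitWithRe_add_conj (s : ℝ) (b : Bool) :
    unitWithRe s b + starRingEnd ℂ (unitWithRe s b) = 2 * s := by
  rw [Complex.add_conj]
  simp [unitWithRe]

theorem conj_unitWithRe_add_conj (s : ℝ) :
    starRingEnd ℂ (unitWithRe s true) + starRingEnd ℂ (unitWithRe s false) = 2 * s := by
  apply Complex.ext <;> simp [unitWithRe]
  ring

theorem unitWithRe_injective {s s' : ℝ} {b b' : Bool} (hs : |s| < 1)
    (h : unitWithRe s b = unitWithRe s' b') : s = s' ∧ b = b' := by
  obtain ⟨rfl, h2⟩ := Complex.ext_iff.1 h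
  refine ⟨rfl, ?_⟩
  have hpos := Real.sqrt_pos.2 (one_sub_sq_pos hs)
  simp only [unitWithRe] at h2 hpos
  cases b <;> cases b' <;> simp only [if_true, Bool.false_eq_true, if_false, reduceCtorEq] at h2 ⊢ <;>
    linarith

end Rotation

variable {V : Type*} [Fintype V] [DecidableEq V] {X : SimpleGraph V} [DecidableRel X.Adj] {a : V}

/-! ### Action of the transition matrix on sums of tail and head functions -/

section Transition

theorem sum_dart_fst_eq {M : Type*} [AddCommMonoid M] (u : V) (F : V → V → M) :
    ∑ e : X.Dart with e.fst = u, F e.fst e.snd = ∑ v, if X.Adj u v then F u v else 0 := by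
  rw [X.dart_fst_fiber, Finset.sum_image (X.dartOfNeighborSet_injective u).injOn,
    ← Finset.sum_filter]
  exact (Finset.sum_subtype (Finset.univ.filter fun v => X.Adj u v)
    (p := fun v => v ∈ X.neighborSet u) (by simp) (fun v => F u v)).symm

theorem arcReversal_mulVec (f : X.Dart → ℂ) (e : X.Dart) :
    (arcReversal X *ᵥ f) e = f e.symm := by
  have h (f' : X.Dart) : e = f'.symm ↔ f' = e.symm :=
    ⟨fun h => by rw [h, SimpleGraph.Dart.symm_symm], fun h => by
      rw [h, SimpleGraph.Dart.symm_symm]⟩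
  simp [Matrix.mulVec, dotProduct, arcReversal, h]

omit [DecidableRel X.Adj] in
theorem tailArc_transpose_mulVec (z : V → ℂ) (e : X.Dart) :
    ((tailArc X)ᵀ *ᵥ z) e = z e.fst := by
  simp [Matrix.mulVec, dotProduct, tailArc]

theorem tailArc_mulVec (α β : V → ℂ) (u : V) :
    (tailArc X *ᵥ fun e => α e.fst + β e.snd) u =
      ∑ v, if X.Adj u v then α u + β v else 0 := by
  rw [← sum_dart_fst_eq u (fun x y => α x + β y), Finset.sum_filter]
  simp [Matrix.mulVec, dotProduct, tailArc, eq_comm (a := u)]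

variable {k : ℕ}

/-- Functions of the form α(tail) + β(head) are mapped to functions of the same form, so eigenvector
equations for `U` become equations on vertices. At a marked head the coin is just -I, and no
condition involving neighbors of a remains. -/
theorem transition_mulVec (hk : 0 < k) (hreg : X.IsRegularOfDegree k) (α β : V → ℂ) (e : X.Dart) :
    (transition X {a} *ᵥ fun e => α e.fst + β e.snd) e =
      (if e.snd = a then 0 else
        2 * α e.snd + 2 / k * ∑ v, if X.Adj e.snd v then β v else 0) - α e.snd - β e.fst := by
  have hk' : (k : ℂ) ≠ 0 := by exact_mod_cast hk.ne'
  have hs : ((((Real.sqrt k)⁻¹ : ℝ) : ℂ)) * (((Real.sqrt k)⁻¹ : ℝ) : ℂ) = (k : ℂ)⁻¹ := by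
    rw [← Complex.ofReal_mul, ← mul_inv, Real.mul_self_sqrt (Nat.cast_nonneg k)]
    push_cast; rfl
  have hsum : (∑ v, if X.Adj e.snd v then α e.snd + β v else 0) =
      k * α e.snd + ∑ v, if X.Adj e.snd v then β v else 0 := by
    have h (v : V) : (if X.Adj e.snd v then α e.snd + β v else 0) =
        (if X.Adj e.snd v then (1 : ℂ) else 0) * α e.snd + if X.Adj e.snd v then β v else 0 := by
      split_ifs <;> simp
    simp only [h, Finset.sum_add_distrib, ← Finset.sum_mul]
    rw [← SimpleGraph.degree_eq_sum_if_adj, hreg.degree_eq]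
  rw [transition, ← Matrix.mulVec_mulVec, arcReversal_mulVec, Matrix.sub_mulVec,
    Matrix.smul_mulVec, Matrix.one_mulVec]
  simp only [← Matrix.mulVec_mulVec, Pi.sub_apply, Pi.smul_apply, smul_eq_mul]
  rw [tailArc_transpose_mulVec]
  simp only [degInvSqrt, unmarkedDiag, Matrix.mulVec_diagonal, tailArc_mulVec, hreg.degree_eq,
    SimpleGraph.Dart.symm, Prod.fst_swap, Prod.snd_swap, Finset.mem_singleton, hsum]
  split_ifs
  · ring
  · have : (2 : ℂ) * ((((Real.sqrt k)⁻¹ : ℝ) : ℂ) * (1 * ((((Real.sqrt k)⁻¹ : ℝ) : ℂ) *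
      (k * α e.snd + ∑ v, if X.Adj e.snd v then β v else 0)))) =
      2 * α e.snd + 2 / k * ∑ v, if X.Adj e.snd v then β v else 0 := by
      calc _ = 2 * (((((Real.sqrt k)⁻¹ : ℝ) : ℂ)) * (((Real.sqrt k)⁻¹ : ℝ) : ℂ)) *
            (k * α e.snd + ∑ v, if X.Adj e.snd v then β v else 0) := by ring
        _ = _ := by rw [hs]; field_simp
    rw [this]; ring

theorem startState_apply (hreg : X.IsRegularOfDegree k) (e : X.Dart) :
    startState X a e = (((Real.sqrt k)⁻¹ : ℝ) : ℂ) * if e.fst = a then 1 else 0 := by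
  rw [startState, hreg.degree_eq, Pi.smul_apply, tailArc_transpose_mulVec, Pi.single_apply,
    smul_eq_mul]

end Transition

/-! ### Eigenvector decomposition of the start state and the exact limit -/

section Decomposition

/-- Extension by zero of a vector on the vertex-deleted graph. -/
def extendZero (z : {v : V // v ≠ a} → ℝ) : V → ℝ := fun v => if h : v ≠ a then z ⟨v, h⟩ else 0

omit [Fintype V] in
@[simp] theorem extendZero_self (z : {v : V // v ≠ a} → ℝ) : extendZero z a = 0 := by
  simp [extendZero]

omit [Fintype V] in
@[simp] theorem extendZero_coe (z : {v : V // v ≠ a} → ℝ) (w : {v : V // v ≠ a}) :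
    extendZero z w = z w := by
  simp [extendZero, w.2]

variable (X a) in
/-- The projection of the neighborhood indicator onto an eigenspace of the deleted graph. -/
def nbrProj (μ : ℝ) : {v : V // v ≠ a} → ℝ :=
  eigproj ((deleteVertex X a).adjMatrix ℝ) μ *ᵥ nbrInd X a

variable (X a) in
/-- The solution of `(Q \ a) p = 1_{N(a)}`. -/
def potential : {v : V // v ≠ a} → ℝ := (minorAt a (signlessLap X))⁻¹ *ᵥ nbrInd X a

variable {k : ℕ}

theorem sum_inv_smul_nbrProj (hconn : X.Connected) (hreg : X.IsRegularOfDegree k) {ε : ℝ}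
    (hε : ε ^ 2 = 1) (w : {v : V // v ≠ a}) :
    ∑ μ ∈ eigvals ((deleteVertex X a).adjMatrix ℝ), (k + ε * μ)⁻¹ * nbrProj X a μ w =
      (((k : ℝ) • 1 + ε • (deleteVertex X a).adjMatrix ℝ)⁻¹ *ᵥ nbrInd X a) w := by
  rw [inv_eq_sum_eigproj (SimpleGraph.isSymm_adjMatrix _) _ _
    fun _ hμ => (add_mul_eigval_pos hconn hreg hε hμ).ne', Matrix.sum_mulVec, Finset.sum_apply]
  refine Finset.sum_congr rfl fun μ _ => ?_
  rw [Matrix.smul_mulVec]; rfl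

theorem isUnit_minor (hconn : X.Connected) (hreg : X.IsRegularOfDegree k) {ε : ℝ}
    (hε : ε ^ 2 = 1) : IsUnit ((k : ℝ) • 1 + ε • (deleteVertex X a).adjMatrix ℝ) :=
  isUnit_smul_one_add_smul (SimpleGraph.isSymm_adjMatrix _) _ _
    fun _ hμ => (add_mul_eigval_pos hconn hreg hε hμ).ne'

theorem isUnit_minorAt_lapMatrix (hconn : X.Connected) (hreg : X.IsRegularOfDegree k) :
    IsUnit (minorAt a (X.lapMatrix ℝ)) := by
  rw [minorAt_lapMatrix hreg]; exact isUnit_minor hconn hreg (by norm_num)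

theorem isUnit_minorAt_signlessLap (hconn : X.Connected) (hreg : X.IsRegularOfDegree k) :
    IsUnit (minorAt a (signlessLap X)) := by
  rw [minorAt_signlessLap hreg]; exact isUnit_minor hconn hreg (by norm_num)

theorem lap_inv_mulVec_nbrInd (hconn : X.Connected) (hreg : X.IsRegularOfDegree k) :
    (minorAt a (X.lapMatrix ℝ))⁻¹ *ᵥ nbrInd X a = fun _ => 1 := by
  rw [← minorAt_lapMatrix_mulVec_one hreg, Matrix.mulVec_mulVec, Matrix.nonsing_inv_mul _
    ((Matrix.isUnit_iff_isUnit_det _).1 (isUnit_minorAt_lapMatrix hconn hreg)), Matrix.one_mulVec]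

theorem sum_inv_sub_nbrProj (hconn : X.Connected) (hreg : X.IsRegularOfDegree k)
    (w : {v : V // v ≠ a}) :
    ∑ μ ∈ eigvals ((deleteVertex X a).adjMatrix ℝ), (k - μ)⁻¹ * nbrProj X a μ w = 1 := by
  have h := sum_inv_smul_nbrProj hconn hreg (ε := -1) (by norm_num) w
  rw [← minorAt_lapMatrix hreg, lap_inv_mulVec_nbrInd hconn hreg] at h
  simpa [← sub_eq_add_neg] using h

theorem sum_inv_add_nbrProj (hconn : X.Connected) (hreg : X.IsRegularOfDegree k)
    (w : {v : V // v ≠ a}) :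
    ∑ μ ∈ eigvals ((deleteVertex X a).adjMatrix ℝ), (k + μ)⁻¹ * nbrProj X a μ w =
      potential X a w := by
  have h := sum_inv_smul_nbrProj hconn hreg (ε := 1) (by norm_num) w
  rw [← minorAt_signlessLap hreg] at h
  simpa [potential] using h

theorem adjMatrix_mulVec_nbrProj (μ : ℝ) (w : {v : V // v ≠ a}) :
    ((deleteVertex X a).adjMatrix ℝ *ᵥ nbrProj X a μ) w = μ * nbrProj X a μ w := by
  rw [nbrProj, Matrix.mulVec_mulVec, mul_eigproj, Matrix.smul_mulVec]; rfl

variable (X a) in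
/-- The vertex vector whose image under the signless Laplacian is supported at the marked vertex. -/
def harmonicVec : V → ℝ := fun v => (if v = a then 1 else 0) - extendZero (potential X a) v

theorem harmonicVec_self : harmonicVec X a a = 1 := by simp [harmonicVec]

theorem harmonicVec_coe (w : {v : V // v ≠ a}) : harmonicVec X a w = -potential X a w := by
  simp [harmonicVec, w.2]

theorem adjMatrix_mulVec_harmonicVec (hconn : X.Connected) (hreg : X.IsRegularOfDegree k)
    (w : {v : V // v ≠ a}) :
    (X.adjMatrix ℝ *ᵥ harmonicVec X a) w = k * potential X a w := by
  have h : minorAt a (signlessLap X) *ᵥ potential X a = nbrInd X a := by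
    rw [potential, Matrix.mulVec_mulVec, Matrix.mul_nonsing_inv _
      ((Matrix.isUnit_iff_isUnit_det _).1 (isUnit_minorAt_signlessLap hconn hreg)),
      Matrix.one_mulVec]
  have h2 := congrFun h w
  rw [minorAt_signlessLap hreg, Matrix.add_mulVec, Matrix.smul_mulVec, Matrix.smul_mulVec,
    Matrix.one_mulVec, Pi.add_apply, Pi.smul_apply, Pi.smul_apply, smul_eq_mul, smul_eq_mul] at h2
  rw [adjMatrix_mulVec_ne, harmonicVec_self]
  simp only [harmonicVec_coe]
  have e : (fun u => -potential X a u) = -potential X a := rfl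
  rw [e, Matrix.mulVec_neg, Pi.neg_apply]
  linarith

variable (X a) in
/-- The phases of the eigenvectors occurring in the initial state. -/
def phase (k : ℕ) : Option (eigvals ((deleteVertex X a).adjMatrix ℝ) × Bool) → ℂ
  | none => -1
  | some (μ, b) => unitWithRe (μ / k) b

variable (X a) in
/-- The eigenvector components of the initial state. -/
def component (k : ℕ) : Option (eigvals ((deleteVertex X a).adjMatrix ℝ) × Bool) → X.Dart → ℂ
  | none => fun e => (((2 * Real.sqrt k)⁻¹ * harmonicVec X a e.fst : ℝ) : ℂ) +
      (((2 * Real.sqrt k)⁻¹ * harmonicVec X a e.snd : ℝ) : ℂ)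
  | some (μ, b) => fun e =>
      -((Real.sqrt k / (2 * ((k : ℝ) ^ 2 - μ ^ 2)) * extendZero (nbrProj X a μ) e.fst : ℝ) : ℂ) *
        starRingEnd ℂ (unitWithRe (μ / k) b) +
      ((Real.sqrt k / (2 * ((k : ℝ) ^ 2 - μ ^ 2)) * extendZero (nbrProj X a μ) e.snd : ℝ) : ℂ)

theorem abs_eigval_div_lt (hk : 0 < k) (hconn : X.Connected) (hreg : X.IsRegularOfDegree k) {μ : ℝ}
    (hμ : μ ∈ eigvals ((deleteVertex X a).adjMatrix ℝ)) : |μ / k| < 1 := by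
  have : (0 : ℝ) < k := by exact_mod_cast hk
  rw [abs_div, Nat.abs_cast, div_lt_one this]
  exact abs_eigval_lt hconn hreg hμ

omit [DecidableEq V] in
theorem sum_adj_ofReal (c : ℝ) (z : V → ℝ) (w : V) :
    (∑ v, if X.Adj w v then ((c * z v : ℝ) : ℂ) else 0) =
      ((c * (X.adjMatrix ℝ *ᵥ z) w : ℝ) : ℂ) := by
  rw [adjMatrix_mulVec_sum, Finset.mul_sum, Complex.ofReal_sum]
  refine Finset.sum_congr rfl fun v _ => ?_
  split_ifs <;> simp

/-- For phase c, the relation 2μ/k - c̄ = c handles unmarked heads, and c c̄ = 1 the tail term; at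
head a the vector vanishes. For phase -1, the relation (A h)(v) = -k h(v) is needed only at v ≠ a,
which is what `harmonicVec` provides. -/
theorem transition_mulVec_component (hk : 0 < k) (hconn : X.Connected)
    (hreg : X.IsRegularOfDegree k)
    (i : Option (eigvals ((deleteVertex X a).adjMatrix ℝ) × Bool)) :
    transition X {a} *ᵥ component X a k i = phase X a k i • component X a k i := by
  have hk' : (k : ℂ) ≠ 0 := by exact_mod_cast hk.ne'
  funext e
  match i with
  | none =>
    unfold component phase
    rw [transition_mulVec hk hreg (fun v => (((2 * Real.sqrt k)⁻¹ * harmonicVec X a v : ℝ) : ℂ))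
      (fun v => (((2 * Real.sqrt k)⁻¹ * harmonicVec X a v : ℝ) : ℂ)), Pi.smul_apply, smul_eq_mul]
    dsimp only
    split_ifs with h
    · ring
    · have h2 := adjMatrix_mulVec_harmonicVec hconn hreg ⟨e.snd, h⟩
      have h3 := harmonicVec_coe (X := X) ⟨e.snd, h⟩
      simp only at h2 h3
      rw [sum_adj_ofReal, h2, h3]
      push_cast
      field_simp
      ring
  | some (μ, b) =>
    have hs := abs_eigval_div_lt hk hconn hreg μ.2
    have hc := conj_mul_unitWithRe hs b
    have hadd := unitWithRe_add_conj (μ / k : ℝ) b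
    unfold component phase
    rw [transition_mulVec hk hreg (fun v => -((Real.sqrt k / (2 * ((k : ℝ) ^ 2 - (μ : ℝ) ^ 2)) *
        extendZero (nbrProj X a μ) v : ℝ) : ℂ) * starRingEnd ℂ (unitWithRe (μ / k) b))
      (fun v => ((Real.sqrt k / (2 * ((k : ℝ) ^ 2 - (μ : ℝ) ^ 2)) *
        extendZero (nbrProj X a μ) v : ℝ) : ℂ)), Pi.smul_apply, smul_eq_mul]
    dsimp only
    set c := unitWithRe (μ / k) b
    split_ifs with h
    · rw [h, extendZero_self]
      push_cast
      linear_combination (Real.sqrt k / (2 * ((k : ℂ) ^ 2 - (μ : ℝ) ^ 2)) *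
        extendZero (nbrProj X a μ) e.fst) * hc
    · have h2 := adjMatrix_mulVec_ne (X := X) (extendZero (nbrProj X a μ)) ⟨e.snd, h⟩
      simp only [extendZero_self, extendZero_coe] at h2
      rw [adjMatrix_mulVec_nbrProj, mul_zero, zero_add] at h2
      have h3 := extendZero_coe (nbrProj X a μ) ⟨e.snd, h⟩
      simp only at h3
      rw [sum_adj_ofReal, h2, h3]
      push_cast at hadd ⊢
      linear_combination (Real.sqrt k / (2 * ((k : ℂ) ^ 2 - (μ : ℝ) ^ 2)) *
        extendZero (nbrProj X a μ) e.fst) * hc - (Real.sqrt k / (2 * ((k : ℂ) ^ 2 - (μ : ℝ) ^ 2)) *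
        nbrProj X a μ ⟨e.snd, h⟩) * hadd

/-- Adding the two phases c, c̄ and splitting 2μ/(k² - μ²) and 2k/(k² - μ²) into partial fractions
leaves two sums over μ: weights 1/(k - μ) give the constant 1 off a, weights 1/(k + μ) give p. The
phase -1 component cancels p and adds the missing mass at a. -/
theorem sum_component (hk : 0 < k) (hconn : X.Connected) (hreg : X.IsRegularOfDegree k) :
    ∑ i, component X a k i = startState X a := by
  have hk' : (0 : ℝ) < k := by exact_mod_cast hk
  have hsq : Real.sqrt k * Real.sqrt k = k := Real.mul_self_sqrt hk'.le
  have hsq0 : Real.sqrt k ≠ 0 := (Real.sqrt_pos.2 hk').ne'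
  funext e
  rw [startState_apply hreg, Finset.sum_apply, Fintype.sum_option, Fintype.sum_prod_type]
  simp only [Fintype.sum_bool, component]
  have hterm (μ : eigvals ((deleteVertex X a).adjMatrix ℝ)) :
      (-((Real.sqrt k / (2 * ((k : ℝ) ^ 2 - μ ^ 2)) * extendZero (nbrProj X a μ) e.fst : ℝ) : ℂ) *
        starRingEnd ℂ (unitWithRe (μ / k) true) +
      ((Real.sqrt k / (2 * ((k : ℝ) ^ 2 - μ ^ 2)) * extendZero (nbrProj X a μ) e.snd : ℝ) : ℂ)) +
      (-((Real.sqrt k / (2 * ((k : ℝ) ^ 2 - μ ^ 2)) * extendZero (nbrProj X a μ) e.fst : ℝ) : ℂ) *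
        starRingEnd ℂ (unitWithRe (μ / k) false) +
      ((Real.sqrt k / (2 * ((k : ℝ) ^ 2 - μ ^ 2)) * extendZero (nbrProj X a μ) e.snd : ℝ) : ℂ)) =
      (((2 * Real.sqrt k)⁻¹ * (-((k - μ : ℝ)⁻¹ * extendZero (nbrProj X a μ) e.fst) +
        (k + μ : ℝ)⁻¹ * extendZero (nbrProj X a μ) e.fst +
        ((k - μ : ℝ)⁻¹ * extendZero (nbrProj X a μ) e.snd) +
        (k + μ : ℝ)⁻¹ * extendZero (nbrProj X a μ) e.snd) : ℝ) : ℂ) := by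
    have h1 : (k : ℝ) - μ ≠ 0 := by
      have := add_mul_eigval_pos hconn hreg (ε := -1) (by norm_num) μ.2
      intro h; linarith
    have h2 : (k : ℝ) + μ ≠ 0 := by
      have := add_mul_eigval_pos hconn hreg (ε := 1) (by norm_num) μ.2
      intro h; linarith
    have h3 : (k : ℝ) ^ 2 - μ ^ 2 ≠ 0 := by
      have : (k : ℝ) ^ 2 - (μ : ℝ) ^ 2 = (k - μ) * (k + μ) := by ring
      rw [this]; exact mul_ne_zero h1 h2
    calc _ = -((Real.sqrt k / (2 * ((k : ℝ) ^ 2 - μ ^ 2)) *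
            extendZero (nbrProj X a μ) e.fst : ℝ) : ℂ) *
          (starRingEnd ℂ (unitWithRe (μ / k) true) + starRingEnd ℂ (unitWithRe (μ / k) false)) +
          2 * ((Real.sqrt k / (2 * ((k : ℝ) ^ 2 - μ ^ 2)) *
            extendZero (nbrProj X a μ) e.snd : ℝ) : ℂ) := by ring
      _ = ((-(Real.sqrt k / (2 * ((k : ℝ) ^ 2 - μ ^ 2)) * extendZero (nbrProj X a μ) e.fst) *
            (2 * (μ / k)) + 2 * (Real.sqrt k / (2 * ((k : ℝ) ^ 2 - μ ^ 2)) *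
            extendZero (nbrProj X a μ) e.snd) : ℝ) : ℂ) := by
          rw [conj_unitWithRe_add_conj]; push_cast; ring
      _ = _ := by
          congr 1
          have e1 : (k - μ : ℝ)⁻¹ = (k + μ) / ((k : ℝ) ^ 2 - μ ^ 2) := by
            field_simp; ring
          have e2 : (k + μ : ℝ)⁻¹ = (k - μ) / ((k : ℝ) ^ 2 - μ ^ 2) := by
            field_simp; ring
          rw [e1, e2]
          generalize extendZero (nbrProj X a μ) e.fst = x
          generalize extendZero (nbrProj X a μ) e.snd = y
          rw [eq_comm]
          field_simp
          rw [pow_two (Real.sqrt k), hsq]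
          ring
  simp only [hterm]
  rw [← Complex.ofReal_sum, ← Finset.mul_sum]
  have hF := fun f : ℝ → ℝ =>
    Finset.sum_coe_sort (eigvals ((deleteVertex X a).adjMatrix ℝ)) f
  rw [hF fun μ => -((k - μ : ℝ)⁻¹ * extendZero (nbrProj X a μ) e.fst) +
        (k + μ : ℝ)⁻¹ * extendZero (nbrProj X a μ) e.fst +
        ((k - μ : ℝ)⁻¹ * extendZero (nbrProj X a μ) e.snd) +
        (k + μ : ℝ)⁻¹ * extendZero (nbrProj X a μ) e.snd]
  simp only [Finset.sum_add_distrib, Finset.sum_neg_distrib]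
  have hm (v : V) : ∑ μ ∈ eigvals ((deleteVertex X a).adjMatrix ℝ),
      (k - μ : ℝ)⁻¹ * extendZero (nbrProj X a μ) v = 1 - if v = a then 1 else 0 := by
    by_cases h : v = a
    · simp [h]
    · have := sum_inv_sub_nbrProj hconn hreg ⟨v, h⟩
      simp [extendZero, h, this]
  have hp (v : V) : ∑ μ ∈ eigvals ((deleteVertex X a).adjMatrix ℝ),
      (k + μ : ℝ)⁻¹ * extendZero (nbrProj X a μ) v = extendZero (potential X a) v := by
    by_cases h : v = a
    · simp [h]
    · have := sum_inv_add_nbrProj hconn hreg ⟨v, h⟩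
      simp [extendZero, h, this]
  simp only [hm, hp, harmonicVec]
  rw [← Complex.ofReal_add, ← Complex.ofReal_add]
  have : (if e.fst = a then (1 : ℂ) else 0) = (((if e.fst = a then 1 else 0 : ℝ)) : ℂ) := by
    split_ifs <;> simp
  rw [this, ← Complex.ofReal_mul]
  congr 1
  field_simp
  ring

variable (X a) in
/-- The value of the average return probability of the marked vertex. -/
def returnValue (k : ℕ) : ℝ :=
  ∑ w ∈ nbrs X a, ((1 - potential X a w) ^ 2 / (4 * k) +
    ∑ μ ∈ eigvals ((deleteVertex X a).adjMatrix ℝ),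
      k / (2 * ((k : ℝ) ^ 2 - μ ^ 2) ^ 2) * nbrProj X a μ w ^ 2)

/-- Since |μ/k| < 1, the real part separates -1 from the other phases and recovers μ, while the
nonzero imaginary part recovers the half-plane. -/
theorem phase_injective (hk : 0 < k) (hconn : X.Connected) (hreg : X.IsRegularOfDegree k) :
    Function.Injective (phase X a k) := by
  have hk' : (k : ℝ) ≠ 0 := by exact_mod_cast hk.ne'
  have hne (μ : eigvals ((deleteVertex X a).adjMatrix ℝ)) (b : Bool) :
      (-1 : ℂ) ≠ unitWithRe (μ / k) b := by
    intro h
    have h2 := congrArg Complex.re h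
    have h3 := abs_eigval_div_lt hk hconn hreg μ.2
    simp only [unitWithRe, Complex.neg_re, Complex.one_re] at h2
    rw [← h2] at h3
    norm_num at h3
  rintro (_ | ⟨μ, b⟩) (_ | ⟨ν, b'⟩) h
  · rfl
  · exact absurd h (hne ν b')
  · exact absurd h.symm (hne μ b)
  · obtain ⟨h1, rfl⟩ := unitWithRe_injective (abs_eigval_div_lt hk hconn hreg μ.2) h
    rw [div_left_inj' hk'] at h1
    rw [Subtype.ext h1]

theorem norm_phase (hk : 0 < k) (hconn : X.Connected) (hreg : X.IsRegularOfDegree k)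
    (i : Option (eigvals ((deleteVertex X a).adjMatrix ℝ) × Bool)) : ‖phase X a k i‖ = 1 := by
  match i with
  | none => simp [phase]
  | some (μ, b) => exact norm_unitWithRe (abs_eigval_div_lt hk hconn hreg μ.2) b

/-- On an arc leaving a the tail terms of the μ-components vanish, so the two conjugate phases
contribute equally; this turns the squared coefficient k/4 into k/2. -/
theorem sum_norm_component_sq (hk : 0 < k) (e : X.Dart) (w : {v : V // v ≠ a}) (h1 : e.fst = a)
    (h2 : e.snd = w) :
    ∑ i, ‖component X a k i e‖ ^ 2 = (1 - potential X a w) ^ 2 / (4 * k) +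
      ∑ μ ∈ eigvals ((deleteVertex X a).adjMatrix ℝ),
        k / (2 * ((k : ℝ) ^ 2 - μ ^ 2) ^ 2) * nbrProj X a μ w ^ 2 := by
  have hk' : (0 : ℝ) < k := by exact_mod_cast hk
  have hsq : Real.sqrt k ^ 2 = k := Real.sq_sqrt hk'.le
  rw [Fintype.sum_option, Fintype.sum_prod_type]
  simp only [Fintype.sum_bool, component]
  rw [h1, h2, harmonicVec_self, harmonicVec_coe]
  congr 1
  · rw [← Complex.ofReal_add, Complex.norm_real, Real.norm_eq_abs, sq_abs]
    have : ((2 * Real.sqrt k)⁻¹ * 1 + (2 * Real.sqrt k)⁻¹ * -potential X a w) ^ 2 =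
        (1 - potential X a w) ^ 2 / (4 * Real.sqrt k ^ 2) := by
      rw [div_eq_mul_inv, mul_inv, mul_inv]; ring
    rw [this, hsq]
  · rw [← Finset.sum_coe_sort (eigvals ((deleteVertex X a).adjMatrix ℝ))
      fun μ => k / (2 * ((k : ℝ) ^ 2 - μ ^ 2) ^ 2) * nbrProj X a μ w ^ 2]
    refine Finset.sum_congr rfl fun μ _ => ?_
    rw [extendZero_self, extendZero_coe, mul_zero, Complex.ofReal_zero, neg_zero, zero_mul,
      zero_mul, zero_add, Complex.norm_real, Real.norm_eq_abs, sq_abs]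
    have : (Real.sqrt k / (2 * ((k : ℝ) ^ 2 - (μ : ℝ) ^ 2)) * nbrProj X a μ w) ^ 2 =
        Real.sqrt k ^ 2 / (4 * ((k : ℝ) ^ 2 - (μ : ℝ) ^ 2) ^ 2) * nbrProj X a μ w ^ 2 := by
      rw [mul_pow, div_pow, mul_pow]; ring
    rw [this, hsq, div_mul_eq_div_div, div_mul_eq_div_div]
    ring

theorem tendsto_timeAverage (hk : 0 < k) (hconn : X.Connected) (hreg : X.IsRegularOfDegree k) :
    Tendsto (timeAverage X {a} a a) atTop (𝓝 (returnValue X a k)) := by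
  have hU (t : ℕ) (e : X.Dart) : ((transition X {a} ^ t) *ᵥ startState X a) e =
      ∑ i, phase X a k i ^ t * component X a k i e := by
    rw [← sum_component hk hconn hreg, pow_mulVec_sum _ (phase X a k) _
      (transition_mulVec_component hk hconn hreg), Finset.sum_apply]
    rfl
  have hlim : Tendsto (fun T : ℕ => ∑ e : X.Dart with e.fst = a, 1 / (T : ℝ) *
      ∑ t ∈ Finset.range T, ‖∑ i, phase X a k i ^ t * component X a k i e‖ ^ 2) atTop
      (𝓝 (∑ e : X.Dart with e.fst = a, ∑ i, ‖component X a k i e‖ ^ 2)) :=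
    tendsto_finsetSum _ fun e _ => tendsto_average_norm_sq _ _ (norm_phase hk hconn hreg)
      (phase_injective hk hconn hreg)
  have hval : ∑ e : X.Dart with e.fst = a, ∑ i, ‖component X a k i e‖ ^ 2 =
      returnValue X a k := by
    -- The value 0 at v = a is a filler: the head of an arc leaving a is never a.
    let F : V → V → ℝ := fun _ v => if h : v ≠ a then
      (1 - potential X a ⟨v, h⟩) ^ 2 / (4 * k) +
      ∑ μ ∈ eigvals ((deleteVertex X a).adjMatrix ℝ),
        k / (2 * ((k : ℝ) ^ 2 - μ ^ 2) ^ 2) * nbrProj X a μ ⟨v, h⟩ ^ 2 else 0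
    have h1 : ∑ e : X.Dart with e.fst = a, ∑ i, ‖component X a k i e‖ ^ 2 =
        ∑ e : X.Dart with e.fst = a, F e.fst e.snd := by
      refine Finset.sum_congr rfl fun e he => ?_
      have he' : e.fst = a := (Finset.mem_filter.1 he).2
      have hs : e.snd ≠ a := fun h => e.adj.ne (he'.trans h.symm)
      rw [sum_norm_component_sq hk e ⟨e.snd, hs⟩ he' rfl]
      simp [F, hs]
    rw [h1, sum_dart_fst_eq, sum_adj_eq_sum_nbrs, returnValue]
    refine Finset.sum_congr rfl fun w _ => ?_
    simp [F, w.2]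
  rw [hval] at hlim
  refine hlim.congr fun T => ?_
  simp only [timeAverage, stepProb, hU]
  rw [← Finset.mul_sum, Finset.sum_comm]

theorem avgMixing_eq (hk : 0 < k) (hconn : X.Connected) (hreg : X.IsRegularOfDegree k) :
    avgMixing X {a} a a = returnValue X a k :=
  (tendsto_timeAverage hk hconn hreg).limUnder_eq

end Decomposition

end MarkedWalk

end

noncomputable section

namespace MarkedWalk

/-! ### Calculus of `elsm` and Schur squares -/

section Elsm

variable {W : Type*} (T : Finset W)

theorem elsm_add (M N : Matrix W W ℝ) : elsm T (M + N) = elsm T M + elsm T N := by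
  simp [elsm, Finset.sum_add_distrib]

theorem elsm_smul (c : ℝ) (M : Matrix W W ℝ) : elsm T (c • M) = c * elsm T M := by
  simp [elsm, Finset.mul_sum]

theorem elsm_sum {ι : Type*} (s : Finset ι) (M : ι → Matrix W W ℝ) :
    elsm T (∑ i ∈ s, M i) = ∑ i ∈ s, elsm T (M i) := by
  induction s using Finset.cons_induction with
  | empty => simp [elsm]
  | cons i s hi ih => rw [Finset.sum_cons, Finset.sum_cons, elsm_add, ih]

theorem elsm_schurSq (M : Matrix W W ℝ) :
    elsm T (schurSq M) = ∑ i ∈ T, ∑ j ∈ T, M i j ^ 2 := by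
  simp [elsm, schurSq, Matrix.hadamard_apply, pow_two]

theorem schurSq_smul (c : ℝ) (M : Matrix W W ℝ) : schurSq (c • M) = c ^ 2 • schurSq M := by
  ext i j
  simp only [schurSq, Matrix.hadamard_apply, Matrix.smul_apply, smul_eq_mul]
  ring

/-- For symmetric G, the matrix GJG is the rank-one matrix (G1)(G1)ᵀ. -/
theorem elsm_mul_allOnes_mul [Fintype W] {G : Matrix W W ℝ} (hG : G.IsSymm) :
    elsm T (G * allOnes * G) = (∑ i ∈ T, (G *ᵥ fun _ => 1) i) ^ 2 := by
  have h (i j : W) : (G * (allOnes : Matrix W W ℝ) * G) i j = (G *ᵥ fun _ => 1) i * (G *ᵥ fun _ => 1) j := by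
    simp only [Matrix.mul_apply, Matrix.mulVec, dotProduct, allOnes, Matrix.of_apply, mul_one]
    rw [← Finset.mul_sum]
    congr 1
    exact Finset.sum_congr rfl fun u _ => hG.apply j u
  simp only [elsm, h]
  rw [pow_two, Finset.sum_mul_sum]

end Elsm

variable {V : Type*} [Fintype V] [DecidableEq V] {X : SimpleGraph V} [DecidableRel X.Adj] {a : V}
  {k : ℕ}

/-! ### Inverses of L\a and Q\a on eigenspaces, their comparison, and the Schur complement -/

section Inverses

theorem sub_eigval_pos (hconn : X.Connected) (hreg : X.IsRegularOfDegree k) {μ : ℝ}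
    (hμ : μ ∈ eigvals ((deleteVertex X a).adjMatrix ℝ)) : 0 < (k : ℝ) - μ := by
  linarith [add_mul_eigval_pos hconn hreg (ε := -1) (by norm_num) hμ]

theorem add_eigval_pos (hconn : X.Connected) (hreg : X.IsRegularOfDegree k) {μ : ℝ}
    (hμ : μ ∈ eigvals ((deleteVertex X a).adjMatrix ℝ)) : 0 < (k : ℝ) + μ := by
  linarith [add_mul_eigval_pos hconn hreg (ε := 1) (by norm_num) hμ]

theorem sq_sub_sq_eigval_pos (hconn : X.Connected) (hreg : X.IsRegularOfDegree k) {μ : ℝ}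
    (hμ : μ ∈ eigvals ((deleteVertex X a).adjMatrix ℝ)) : 0 < (k : ℝ) ^ 2 - μ ^ 2 := by
  nlinarith [mul_pos (sub_eigval_pos hconn hreg hμ) (add_eigval_pos hconn hreg hμ)]

theorem lap_inv_mul_eigproj (hconn : X.Connected) (hreg : X.IsRegularOfDegree k) {μ : ℝ}
    (hμ : μ ∈ eigvals ((deleteVertex X a).adjMatrix ℝ)) :
    (minorAt a (X.lapMatrix ℝ))⁻¹ * eigproj ((deleteVertex X a).adjMatrix ℝ) μ =
      ((k : ℝ) - μ)⁻¹ • eigproj ((deleteVertex X a).adjMatrix ℝ) μ := by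
  rw [minorAt_lapMatrix hreg, inv_mul_eigproj _ _
    (fun _ h => (add_mul_eigval_pos hconn hreg (by norm_num) h).ne')
    (isUnit_minor hconn hreg (by norm_num)) hμ, neg_one_mul, sub_eq_add_neg]

theorem signlessLap_inv_mul_eigproj (hconn : X.Connected) (hreg : X.IsRegularOfDegree k) {μ : ℝ}
    (hμ : μ ∈ eigvals ((deleteVertex X a).adjMatrix ℝ)) :
    (minorAt a (signlessLap X))⁻¹ * eigproj ((deleteVertex X a).adjMatrix ℝ) μ =
      ((k : ℝ) + μ)⁻¹ • eigproj ((deleteVertex X a).adjMatrix ℝ) μ := by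
  rw [minorAt_signlessLap hreg, inv_mul_eigproj _ _
    (fun _ h => (add_mul_eigval_pos hconn hreg (by norm_num) h).ne')
    (isUnit_minor hconn hreg (by norm_num)) hμ, one_mul]

theorem eigproj_mul_signlessLap_inv (hconn : X.Connected) (hreg : X.IsRegularOfDegree k) {μ : ℝ}
    (hμ : μ ∈ eigvals ((deleteVertex X a).adjMatrix ℝ)) :
    eigproj ((deleteVertex X a).adjMatrix ℝ) μ * (minorAt a (signlessLap X))⁻¹ =
      ((k : ℝ) + μ)⁻¹ • eigproj ((deleteVertex X a).adjMatrix ℝ) μ := by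
  rw [minorAt_signlessLap hreg, eigproj_mul_inv (SimpleGraph.isSymm_adjMatrix _) _ _
    (fun _ h => (add_mul_eigval_pos hconn hreg (by norm_num) h).ne')
    (isUnit_minor hconn hreg (by norm_num)) hμ, one_mul]

theorem schurSq_lap_inv_mul (hconn : X.Connected) (hreg : X.IsRegularOfDegree k) {μ : ℝ}
    (hμ : μ ∈ eigvals ((deleteVertex X a).adjMatrix ℝ)) :
    schurSq ((minorAt a (X.lapMatrix ℝ))⁻¹ * (minorAt a (signlessLap X))⁻¹ *
      eigproj ((deleteVertex X a).adjMatrix ℝ) μ) =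
      (1 / ((k : ℝ) ^ 2 - μ ^ 2) ^ 2) • schurSq (eigproj ((deleteVertex X a).adjMatrix ℝ) μ) := by
  rw [mul_assoc, signlessLap_inv_mul_eigproj hconn hreg hμ, Matrix.mul_smul,
    lap_inv_mul_eigproj hconn hreg hμ, smul_smul, schurSq_smul]
  congr 1
  rw [← mul_inv, inv_pow, one_div]
  congr 2
  ring

theorem sum_smul_schurSq_eq (hconn : X.Connected) (hreg : X.IsRegularOfDegree k) (c : ℝ) :
    ∑ μ ∈ eigvals ((deleteVertex X a).adjMatrix ℝ), (c / ((k : ℝ) ^ 2 - μ ^ 2) ^ 2) •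
      schurSq (eigproj ((deleteVertex X a).adjMatrix ℝ) μ) =
    c • ∑ μ ∈ eigvals ((deleteVertex X a).adjMatrix ℝ),
      schurSq ((minorAt a (X.lapMatrix ℝ))⁻¹ * (minorAt a (signlessLap X))⁻¹ *
        eigproj ((deleteVertex X a).adjMatrix ℝ) μ) := by
  rw [Finset.smul_sum]
  refine Finset.sum_congr rfl fun μ hμ => ?_
  rw [schurSq_lap_inv_mul hconn hreg hμ, smul_smul, mul_one_div]

theorem signlessLap_inv_mul_sum_mul (hconn : X.Connected) (hreg : X.IsRegularOfDegree k)
    (J : Matrix {v : V // v ≠ a} {v : V // v ≠ a} ℝ) :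
    (minorAt a (signlessLap X))⁻¹ * (∑ μ ∈ eigvals ((deleteVertex X a).adjMatrix ℝ),
      eigproj ((deleteVertex X a).adjMatrix ℝ) μ * J *
        eigproj ((deleteVertex X a).adjMatrix ℝ) μ) * (minorAt a (signlessLap X))⁻¹ =
    ∑ μ ∈ eigvals ((deleteVertex X a).adjMatrix ℝ), (1 / ((k : ℝ) + μ) ^ 2) •
      (eigproj ((deleteVertex X a).adjMatrix ℝ) μ * J *
        eigproj ((deleteVertex X a).adjMatrix ℝ) μ) := by
  rw [Finset.mul_sum, Finset.sum_mul]
  refine Finset.sum_congr rfl fun μ hμ => ?_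
  rw [← mul_assoc, ← mul_assoc, signlessLap_inv_mul_eigproj hconn hreg hμ, mul_assoc,
    eigproj_mul_signlessLap_inv hconn hreg hμ, Matrix.mul_smul, Matrix.smul_mul, Matrix.smul_mul,
    smul_smul, ← pow_two, inv_pow, one_div]

theorem elsm_eigproj (μ : ℝ) : elsm (nbrs X a) (eigproj ((deleteVertex X a).adjMatrix ℝ) μ) =
    ∑ w ∈ nbrs X a, nbrProj X a μ w :=
  elsm_nbrs _

/-- As 1_{N(a)} = (L\a)1, one has G_μ 1_{N(a)} = (k - μ) G_μ 1, and the factor (k - μ)² cancels from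
(k² - μ²)². -/
theorem elsm_eigproj_mul_allOnes (hconn : X.Connected) (hreg : X.IsRegularOfDegree k) {μ : ℝ}
    (hμ : μ ∈ eigvals ((deleteVertex X a).adjMatrix ℝ)) :
    1 / ((k : ℝ) ^ 2 - μ ^ 2) ^ 2 *
        elsm (nbrs X a) (eigproj ((deleteVertex X a).adjMatrix ℝ) μ) ^ 2 =
      1 / ((k : ℝ) + μ) ^ 2 * elsm (nbrs X a) (eigproj ((deleteVertex X a).adjMatrix ℝ) μ *
        allOnes * eigproj ((deleteVertex X a).adjMatrix ℝ) μ) := by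
  have h1 := (sub_eigval_pos hconn hreg hμ).ne'
  have h2 := (add_eigval_pos hconn hreg hμ).ne'
  have h (w : {v : V // v ≠ a}) : nbrProj X a μ w =
      (k - μ) * (eigproj ((deleteVertex X a).adjMatrix ℝ) μ *ᵥ fun _ => 1) w := by
    rw [nbrProj, ← minorAt_lapMatrix_mulVec_one hreg, Matrix.mulVec_mulVec, minorAt_lapMatrix hreg,
      mul_add, Matrix.mul_smul, Matrix.mul_smul, mul_one,
      eigproj_mul (SimpleGraph.isSymm_adjMatrix _), smul_smul, ← add_smul, Matrix.smul_mulVec,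
      Pi.smul_apply, smul_eq_mul]
    ring
  rw [elsm_mul_allOnes_mul _ (eigproj_isSymm _ μ), elsm_eigproj]
  simp only [h]
  rw [← Finset.mul_sum]
  have : (k : ℝ) ^ 2 - μ ^ 2 = (k - μ) * (k + μ) := by ring
  rw [this]
  field_simp

/-- This is the Neumann series, summed on each eigenspace as a geometric series of ratio εμ/k. -/
theorem hasSum_pow_apply (hk : 0 < k) (hconn : X.Connected) (hreg : X.IsRegularOfDegree k) {ε : ℝ}
    (hε : ε ^ 2 = 1) (i j : {v : V // v ≠ a}) :
    HasSum (fun n : ℕ => ε ^ n * ((k : ℝ)⁻¹ ^ (n + 1) * ((deleteVertex X a).adjMatrix ℝ ^ n) i j))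
      (((k : ℝ) • 1 + (-ε) • (deleteVertex X a).adjMatrix ℝ)⁻¹ i j) := by
  have hk' : (0 : ℝ) < k := by exact_mod_cast hk
  have hε' : |ε| = 1 := by rw [← sq_eq_sq₀ (abs_nonneg _) zero_le_one, sq_abs, hε, one_pow]
  have hneg : (-ε) ^ 2 = 1 := by rw [neg_sq, hε]
  rw [inv_eq_sum_eigproj (SimpleGraph.isSymm_adjMatrix _) _ _
    fun μ hμ => (add_mul_eigval_pos hconn hreg hneg hμ).ne', Matrix.sum_apply]
  simp only [pow_eq_sum_eigproj (SimpleGraph.isSymm_adjMatrix (deleteVertex X a)),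
    Matrix.sum_apply, Finset.mul_sum]
  refine hasSum_sum fun μ hμ => ?_
  have hlt : |ε * (μ / k)| < 1 := by
    rw [abs_mul, hε', one_mul]; exact abs_eigval_div_lt hk hconn hreg hμ
  have h := (hasSum_geometric_of_abs_lt_one hlt).mul_right
    ((k : ℝ)⁻¹ * eigproj ((deleteVertex X a).adjMatrix ℝ) μ i j)
  convert h using 1
  · rfl
  · funext n
    rw [show (μ ^ n • eigproj ((deleteVertex X a).adjMatrix ℝ) μ) i j =
      μ ^ n * eigproj ((deleteVertex X a).adjMatrix ℝ) μ i j from rfl, mul_pow, div_pow, div_eq_mul_inv, ← inv_pow]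
    ring
  · rw [Matrix.smul_apply, smul_eq_mul, ← mul_assoc, ← mul_inv]
    congr 2
    field_simp
    ring

/-- The Neumann series of the two inverses differ only by signs (-1)^n, and the unsigned terms are
nonnegative multiples of walk counts. -/
theorem abs_signlessLap_inv_le (hk : 0 < k) (hconn : X.Connected) (hreg : X.IsRegularOfDegree k)
    (i j : {v : V // v ≠ a}) :
    |(minorAt a (signlessLap X))⁻¹ i j| ≤ (minorAt a (X.lapMatrix ℝ))⁻¹ i j := by
  have hL := hasSum_pow_apply hk hconn hreg (ε := 1) (by norm_num) i j
  have hQ := hasSum_pow_apply hk hconn hreg (ε := -1) (by norm_num) i j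
  rw [← minorAt_lapMatrix hreg] at hL
  rw [neg_neg, ← minorAt_signlessLap hreg] at hQ
  have hnn (n : ℕ) : 0 ≤ (k : ℝ)⁻¹ ^ (n + 1) * ((deleteVertex X a).adjMatrix ℝ ^ n) i j := by
    rw [SimpleGraph.adjMatrix_pow_apply_eq_card_walk]; positivity
  rw [abs_le]
  constructor
  · refine hasSum_le (fun n => ?_) hL.neg hQ
    rw [one_pow, one_mul]
    rcases neg_one_pow_eq_or ℝ n with h | h <;> rw [h] <;> linarith [hnn n]
  · refine hasSum_le (fun n => ?_) hQ hL
    rw [one_pow, one_mul]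
    rcases neg_one_pow_eq_or ℝ n with h | h <;> rw [h] <;> linarith [hnn n]

theorem elsm_schurSq_signlessLap_inv_le (hk : 0 < k) (hconn : X.Connected)
    (hreg : X.IsRegularOfDegree k) :
    elsm (nbrs X a) (schurSq (minorAt a (signlessLap X))⁻¹) ≤
      elsm (nbrs X a) (schurSq (minorAt a (X.lapMatrix ℝ))⁻¹) := by
  rw [elsm_schurSq, elsm_schurSq]
  refine Finset.sum_le_sum fun i _ => Finset.sum_le_sum fun j _ => ?_
  have := abs_signlessLap_inv_le hk hconn hreg i j
  exact sq_le_sq' (abs_le.1 this).1 (abs_le.1 this).2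

theorem signlessLap_mulVec_harmonicVec (hconn : X.Connected) (hreg : X.IsRegularOfDegree k) :
    signlessLap X *ᵥ harmonicVec X a =
      Pi.single a ((k : ℝ) - elsm (nbrs X a) (minorAt a (signlessLap X))⁻¹) := by
  funext v
  rw [signlessLap_mulVec hreg]
  by_cases h : v = a
  · subst h
    rw [adjMatrix_mulVec_self, harmonicVec_self, Pi.single_eq_same, elsm_nbrs]
    simp only [harmonicVec_coe, Finset.sum_neg_distrib, potential]
    ring
  · rw [Pi.single_eq_of_ne h]
    have h1 := adjMatrix_mulVec_harmonicVec hconn hreg ⟨v, h⟩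
    have h2 := harmonicVec_coe (X := X) ⟨v, h⟩
    simp only at h1 h2
    rw [h1, h2]
    ring

/-- With σ the Schur complement, Qh = σ e_a; applying Q⁻¹ and reading off the entry h(a) = 1 gives
the identity. -/
theorem schur_mul_signlessLap_inv (hconn : X.Connected) (hreg : X.IsRegularOfDegree k)
    (hb : ¬ X.IsBipartite) :
    ((k : ℝ) - elsm (nbrs X a) (minorAt a (signlessLap X))⁻¹) * (signlessLap X)⁻¹ a a = 1 := by
  have h := congrArg (fun z => ((signlessLap X)⁻¹ *ᵥ z) a)
    (signlessLap_mulVec_harmonicVec (a := a) hconn hreg)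
  simp only [Matrix.mulVec_mulVec] at h
  rw [Matrix.nonsing_inv_mul _ ((Matrix.isUnit_iff_isUnit_det _).1
    (isUnit_signlessLap hconn hreg hb)), Matrix.one_mulVec, harmonicVec_self] at h
  rw [h]
  simp [Matrix.mulVec, dotProduct, Pi.single_apply, mul_comm]

/-- The Schur complement is the value hᵀQh of a nonnegative form, because Qh is supported at a,
where h is 1. -/
theorem schur_nonneg (hconn : X.Connected) (hreg : X.IsRegularOfDegree k) :
    0 ≤ (k : ℝ) - elsm (nbrs X a) (minorAt a (signlessLap X))⁻¹ := by
  have h := sum_sum_adj_sq hreg (ε := 1) (by norm_num) (harmonicVec X a)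
  have hnn : 0 ≤ ∑ i, ∑ j, (if X.Adj i j then
      (harmonicVec X a i + 1 * harmonicVec X a j) ^ 2 else 0) :=
    Finset.sum_nonneg fun i _ => Finset.sum_nonneg fun j _ => by split_ifs <;> positivity
  rw [h] at hnn
  simp only [one_mul, ← signlessLap_mulVec hreg, signlessLap_mulVec_harmonicVec hconn hreg] at hnn
  rw [Finset.sum_eq_single a (fun i _ hi => by rw [Pi.single_eq_of_ne hi, mul_zero]) (by simp),
    harmonicVec_self, Pi.single_eq_same] at hnn
  linarith

end Inverses

/-! ### Cauchy-Schwarz defects and the equality cases -/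

section Bounds

variable (X a) in
/-- The lower bound, uniform in the bipartite and the non-bipartite case. -/
def lowerBound (k : ℕ) : ℝ :=
  1 / 2 * (∑ μ ∈ eigvals ((deleteVertex X a).adjMatrix ℝ), 1 / ((k : ℝ) ^ 2 - μ ^ 2) ^ 2 *
    elsm (nbrs X a) (eigproj ((deleteVertex X a).adjMatrix ℝ) μ) ^ 2) +
    ((k : ℝ) - elsm (nbrs X a) (minorAt a (signlessLap X))⁻¹) ^ 2 / (4 * (k : ℝ) ^ 2)

variable (X a) in
/-- The upper bound, uniform in the bipartite and the non-bipartite case. -/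
def upperBound (k : ℕ) : ℝ :=
  1 / 4 * elsm (nbrs X a)
    ((∑ μ ∈ eigvals ((deleteVertex X a).adjMatrix ℝ),
      (2 * (k : ℝ) ^ 2 / ((k : ℝ) ^ 2 - μ ^ 2) ^ 2) •
        schurSq (eigproj ((deleteVertex X a).adjMatrix ℝ) μ))
      + schurSq (minorAt a (X.lapMatrix ℝ))⁻¹ + schurSq (minorAt a (signlessLap X))⁻¹)
    + ((k : ℝ) - elsm (nbrs X a) (minorAt a (signlessLap X))⁻¹) / (2 * k) - 1 / 2

/-- Expressing the gap as a nonnegative combination of Cauchy-Schwarz defects over N(a) yields both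
the inequality and its equality case. -/
theorem returnValue_sub_lowerBound (hk : 0 < k) (hreg : X.IsRegularOfDegree k) :
    returnValue X a k - lowerBound X a k =
      (∑ μ ∈ eigvals ((deleteVertex X a).adjMatrix ℝ), 1 / (2 * ((k : ℝ) ^ 2 - μ ^ 2) ^ 2) *
        ((nbrs X a).card * ∑ w ∈ nbrs X a, nbrProj X a μ w ^ 2 -
          (∑ w ∈ nbrs X a, nbrProj X a μ w) ^ 2)) +
      1 / (4 * (k : ℝ) ^ 2) * ((nbrs X a).card * ∑ w ∈ nbrs X a, (1 - potential X a w) ^ 2 -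
          (∑ w ∈ nbrs X a, (1 - potential X a w)) ^ 2) := by
  have hk' : (k : ℝ) ≠ 0 := by exact_mod_cast hk.ne'
  rw [returnValue, lowerBound, Finset.sum_add_distrib, Finset.sum_comm (s := nbrs X a),
    elsm_nbrs, Finset.sum_sub_distrib, Finset.sum_const, card_nbrs hreg, nsmul_eq_mul, mul_one,
    ← Finset.sum_div]
  simp only [elsm_eigproj, ← Finset.mul_sum]
  have e (μ : ℝ) : 1 / (2 * ((k : ℝ) ^ 2 - μ ^ 2) ^ 2) *
        (k * ∑ w ∈ nbrs X a, nbrProj X a μ w ^ 2 - (∑ w ∈ nbrs X a, nbrProj X a μ w) ^ 2) =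
      k / (2 * ((k : ℝ) ^ 2 - μ ^ 2) ^ 2) * ∑ w ∈ nbrs X a, nbrProj X a μ w ^ 2 -
        1 / 2 * (1 / ((k : ℝ) ^ 2 - μ ^ 2) ^ 2 * (∑ w ∈ nbrs X a, nbrProj X a μ w) ^ 2) := by
    rw [← mul_assoc (1 / 2 : ℝ), one_div_mul_one_div]
    ring
  have e' : 1 / (4 * (k : ℝ) ^ 2) * (k * ∑ w ∈ nbrs X a, (1 - potential X a w) ^ 2) =
      (∑ w ∈ nbrs X a, (1 - potential X a w) ^ 2) / (4 * k) := by
    field_simp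
  simp only [e, Finset.sum_sub_distrib, ← Finset.mul_sum, mul_sub, e']
  change _ + _ - (_ + (↑k - ∑ w ∈ nbrs X a, potential X a w) ^ 2 / _) = _
  rw [one_div_mul_eq_div (4 * (k : ℝ) ^ 2)]
  abel

theorem lowerBound_le (hk : 0 < k) (hreg : X.IsRegularOfDegree k) :
    lowerBound X a k ≤ returnValue X a k := by
  rw [← sub_nonneg, returnValue_sub_lowerBound hk hreg]
  refine add_nonneg (Finset.sum_nonneg fun μ _ => ?_) ?_ <;>
    exact mul_nonneg (by positivity) (card_mul_sum_sq_sub_sq_sum_nonneg _ _)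

theorem pow_mulVec_nbrInd (m : ℕ) (w : {v : V // v ≠ a}) :
    (((deleteVertex X a).adjMatrix ℝ) ^ m *ᵥ nbrInd X a) w =
      ∑ μ ∈ eigvals ((deleteVertex X a).adjMatrix ℝ), μ ^ m * nbrProj X a μ w := by
  rw [pow_eq_sum_eigproj (SimpleGraph.isSymm_adjMatrix _), Matrix.sum_mulVec, Finset.sum_apply]
  refine Finset.sum_congr rfl fun μ _ => ?_
  rw [Matrix.smul_mulVec]; rfl

/-- The number of walks from w is Σ_μ μ^m g_μ(w); since the eigenvalues are distinct, agreement for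
all m separates into agreement of each g_μ. -/
theorem numWalks_eq_iff :
    (∀ m : ℕ, ∀ w ∈ nbrs X a, ∀ w' ∈ nbrs X a,
      numWalks (deleteVertex X a) m w (nbrs X a) = numWalks (deleteVertex X a) m w' (nbrs X a)) ↔
    ∀ μ ∈ eigvals ((deleteVertex X a).adjMatrix ℝ), ∀ w ∈ nbrs X a, ∀ w' ∈ nbrs X a,
      nbrProj X a μ w = nbrProj X a μ w' := by
  constructor
  · intro h μ hμ w hw w' hw'
    refine sub_eq_zero.1 (forall_eq_zero_of_sum_pow_mul_eq_zero _
      (fun μ => nbrProj X a μ w - nbrProj X a μ w') (fun m => ?_) μ hμ)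
    simp only [mul_sub, Finset.sum_sub_distrib]
    rw [← pow_mulVec_nbrInd, ← pow_mulVec_nbrInd, ← walk_count_eq_pow_mulVec,
      ← walk_count_eq_pow_mulVec, h m w hw w' hw', sub_self]
  · intro h m w hw w' hw'
    have : (numWalks (deleteVertex X a) m w (nbrs X a) : ℝ) =
        numWalks (deleteVertex X a) m w' (nbrs X a) := by
      rw [walk_count_eq_pow_mulVec, walk_count_eq_pow_mulVec, pow_mulVec_nbrInd, pow_mulVec_nbrInd]
      exact Finset.sum_congr rfl fun μ hμ => by rw [h μ hμ w hw w' hw']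
    exact_mod_cast this

theorem returnValue_eq_lowerBound_iff (hk : 0 < k) (hconn : X.Connected)
    (hreg : X.IsRegularOfDegree k) :
    returnValue X a k = lowerBound X a k ↔
      ∀ m : ℕ, ∀ w ∈ nbrs X a, ∀ w' ∈ nbrs X a,
        numWalks (deleteVertex X a) m w (nbrs X a) =
          numWalks (deleteVertex X a) m w' (nbrs X a) := by
  have hk' : (0 : ℝ) < k := by exact_mod_cast hk
  have hc (μ : ℝ) (hμ : μ ∈ eigvals ((deleteVertex X a).adjMatrix ℝ)) :
      1 / (2 * ((k : ℝ) ^ 2 - μ ^ 2) ^ 2) ≠ 0 := by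
    have := sq_sub_sq_eigval_pos hconn hreg hμ
    positivity
  have hnn (μ : ℝ) : 0 ≤ 1 / (2 * ((k : ℝ) ^ 2 - μ ^ 2) ^ 2) *
        ((nbrs X a).card * ∑ w ∈ nbrs X a, nbrProj X a μ w ^ 2 -
          (∑ w ∈ nbrs X a, nbrProj X a μ w) ^ 2) :=
    mul_nonneg (by positivity) (card_mul_sum_sq_sub_sq_sum_nonneg _ _)
  rw [numWalks_eq_iff, ← sub_eq_zero, returnValue_sub_lowerBound hk hreg,
    add_eq_zero_iff_of_nonneg (Finset.sum_nonneg fun μ _ => hnn μ)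
      (mul_nonneg (by positivity) (card_mul_sum_sq_sub_sq_sum_nonneg _ _)),
    Finset.sum_eq_zero_iff_of_nonneg fun μ _ => hnn μ]
  constructor
  · rintro ⟨h, -⟩ μ hμ
    exact (sq_sum_eq_card_mul_sum_sq_iff _ _).1 ((mul_eq_zero_iff_left (hc μ hμ)).1 (h μ hμ))
  · intro h
    refine ⟨fun μ hμ => ?_, ?_⟩
    · rw [(sq_sum_eq_card_mul_sum_sq_iff _ _).2 (h μ hμ), mul_zero]
    · rw [(sq_sum_eq_card_mul_sum_sq_iff _ _).2, mul_zero]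
      -- The defect of phase -1 imposes no further condition: p is the combination Σ_μ g_μ/(k + μ),
      -- so it is constant on N(a) once all g_μ are.
      intro w hw w' hw'
      rw [← sum_inv_add_nbrProj hconn hreg, ← sum_inv_add_nbrProj hconn hreg]
      congr 1
      exact Finset.sum_congr rfl fun μ hμ => by rw [h μ hμ w hw w' hw']

/-- The defect in the Cauchy-Schwarz inequality for the row sums of a matrix over `T`. -/
def rowDefect {W : Type*} (T : Finset W) (M : Matrix W W ℝ) : ℝ :=
  ∑ w ∈ T, (T.card * ∑ u ∈ T, M w u ^ 2 - (∑ u ∈ T, M w u) ^ 2)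

theorem rowDefect_nonneg {W : Type*} (T : Finset W) (M : Matrix W W ℝ) : 0 ≤ rowDefect T M :=
  Finset.sum_nonneg fun w _ => card_mul_sum_sq_sub_sq_sum_nonneg T (M w)

theorem rowDefect_eq_zero_iff {W : Type*} (T : Finset W) (M : Matrix W W ℝ) :
    rowDefect T M = 0 ↔ ∀ w ∈ T, ∀ u ∈ T, ∀ u' ∈ T, M w u = M w u' := by
  rw [rowDefect, Finset.sum_eq_zero_iff_of_nonneg
    fun w _ => card_mul_sum_sq_sub_sq_sum_nonneg T (M w)]
  exact forall₂_congr fun w _ => sq_sum_eq_card_mul_sum_sq_iff T (M w)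

theorem rowDefect_eq {W : Type*} (T : Finset W) (M : Matrix W W ℝ) :
    rowDefect T M = T.card * elsm T (schurSq M) - ∑ w ∈ T, (∑ u ∈ T, M w u) ^ 2 := by
  rw [rowDefect, elsm_schurSq, Finset.sum_sub_distrib, Finset.mul_sum]

/-- Expanding (1 - p)² as 1 - 2p + p², the terms 1 and p² are squared row sums of (L\a)⁻¹ and
(Q\a)⁻¹ and are each estimated by Cauchy-Schwarz; the linear term is kept exactly, as the Schur
complement in the bound. -/
theorem upperBound_sub_returnValue (hk : 0 < k) (hconn : X.Connected)
    (hreg : X.IsRegularOfDegree k) :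
    upperBound X a k - returnValue X a k =
      (∑ μ ∈ eigvals ((deleteVertex X a).adjMatrix ℝ), k / (2 * ((k : ℝ) ^ 2 - μ ^ 2) ^ 2) *
        rowDefect (nbrs X a) (eigproj ((deleteVertex X a).adjMatrix ℝ) μ)) +
      1 / (4 * (k : ℝ)) * (rowDefect (nbrs X a) (minorAt a (X.lapMatrix ℝ))⁻¹ +
        rowDefect (nbrs X a) (minorAt a (signlessLap X))⁻¹) := by
  have hk' : (k : ℝ) ≠ 0 := by exact_mod_cast hk.ne'
  have hL : ∀ w, ∑ u ∈ nbrs X a, (minorAt a (X.lapMatrix ℝ))⁻¹ w u = 1 := fun w => by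
    rw [← mulVec_nbrInd, lap_inv_mulVec_nbrInd hconn hreg]
  have hQ : ∀ w, ∑ u ∈ nbrs X a, (minorAt a (signlessLap X))⁻¹ w u = potential X a w := fun w => by
    rw [← mulVec_nbrInd]; rfl
  have hG : ∀ μ w, ∑ u ∈ nbrs X a, eigproj ((deleteVertex X a).adjMatrix ℝ) μ w u =
      nbrProj X a μ w := fun μ w => by
    rw [← mulVec_nbrInd]; rfl
  have hp : ∑ w ∈ nbrs X a, (1 - potential X a w) ^ 2 =
      k - 2 * ∑ w ∈ nbrs X a, potential X a w + ∑ w ∈ nbrs X a, potential X a w ^ 2 := by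
    have h (w) : (1 - potential X a w) ^ 2 = 1 - 2 * potential X a w + potential X a w ^ 2 := by
      ring
    simp only [h, Finset.sum_add_distrib, Finset.sum_sub_distrib, ← Finset.mul_sum,
      Finset.sum_const, card_nbrs hreg, nsmul_eq_mul, mul_one]
  have hE : elsm (nbrs X a) (minorAt a (signlessLap X))⁻¹ = ∑ w ∈ nbrs X a, potential X a w :=
    elsm_nbrs _
  simp only [rowDefect_eq, hL, hQ, hG, card_nbrs hreg, one_pow, Finset.sum_const, nsmul_eq_mul,
    mul_one]
  rw [returnValue, upperBound, Finset.sum_add_distrib, Finset.sum_comm (s := nbrs X a),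
    ← Finset.sum_div, hp, hE]
  simp only [elsm_add, elsm_sum, elsm_smul, ← Finset.mul_sum]
  have e (μ : ℝ) : k / (2 * ((k : ℝ) ^ 2 - μ ^ 2) ^ 2) *
        (k * elsm (nbrs X a) (schurSq (eigproj ((deleteVertex X a).adjMatrix ℝ) μ)) -
          ∑ w ∈ nbrs X a, nbrProj X a μ w ^ 2) =
      1 / 4 * (2 * (k : ℝ) ^ 2 / ((k : ℝ) ^ 2 - μ ^ 2) ^ 2 *
        elsm (nbrs X a) (schurSq (eigproj ((deleteVertex X a).adjMatrix ℝ) μ))) -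
      k / (2 * ((k : ℝ) ^ 2 - μ ^ 2) ^ 2) * ∑ w ∈ nbrs X a, nbrProj X a μ w ^ 2 := by
    rw [div_mul_eq_div_div_swap]
    ring
  simp only [e, Finset.sum_sub_distrib, ← Finset.mul_sum]
  field_simp
  ring

theorem le_upperBound (hk : 0 < k) (hconn : X.Connected) (hreg : X.IsRegularOfDegree k) :
    returnValue X a k ≤ upperBound X a k := by
  rw [← sub_nonneg, upperBound_sub_returnValue hk hconn hreg]
  exact add_nonneg (Finset.sum_nonneg fun μ _ => mul_nonneg (by positivity) (rowDefect_nonneg _ _))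
    (mul_nonneg (by positivity) (add_nonneg (rowDefect_nonneg _ _) (rowDefect_nonneg _ _)))

theorem returnValue_eq_upperBound_iff (hk : 0 < k) (hconn : X.Connected)
    (hreg : X.IsRegularOfDegree k) :
    returnValue X a k = upperBound X a k ↔ Nonempty (X ≃g (⊤ : SimpleGraph (Fin 2))) := by
  rw [nonempty_iso_top_fin_two_iff hk hconn hreg, eq_comm, ← sub_eq_zero,
    upperBound_sub_returnValue hk hconn hreg]
  constructor
  · intro h
    have hnn (μ : ℝ) : 0 ≤ k / (2 * ((k : ℝ) ^ 2 - μ ^ 2) ^ 2) *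
        rowDefect (nbrs X a) (eigproj ((deleteVertex X a).adjMatrix ℝ) μ) :=
      mul_nonneg (by positivity) (rowDefect_nonneg _ _)
    rw [add_eq_zero_iff_of_nonneg (Finset.sum_nonneg fun μ _ => hnn μ)
      (mul_nonneg (by positivity) (add_nonneg (rowDefect_nonneg _ _) (rowDefect_nonneg _ _))),
      Finset.sum_eq_zero_iff_of_nonneg fun μ _ => hnn μ] at h
    have hG (μ : ℝ) (hμ : μ ∈ eigvals ((deleteVertex X a).adjMatrix ℝ)) :
        ∀ w ∈ nbrs X a, ∀ u ∈ nbrs X a, ∀ u' ∈ nbrs X a,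
          eigproj ((deleteVertex X a).adjMatrix ℝ) μ w u =
            eigproj ((deleteVertex X a).adjMatrix ℝ) μ w u' := by
      have hc : (k : ℝ) / (2 * ((k : ℝ) ^ 2 - μ ^ 2) ^ 2) ≠ 0 := by
        have h1 := sq_sub_sq_eigval_pos hconn hreg hμ
        have h2 : (0 : ℝ) < k := by exact_mod_cast hk
        positivity
      exact (rowDefect_eq_zero_iff _ _).1 ((mul_eq_zero_iff_left hc).1 (h.1 μ hμ))
    rw [← card_nbrs (a := a) hreg]
    refine le_antisymm (Finset.card_le_one.2 fun w hw u hu => ?_) ?_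
    · by_contra hne
      have h1 := congrFun (congrFun (sum_eigproj (A := (deleteVertex X a).adjMatrix ℝ)
        (SimpleGraph.isSymm_adjMatrix _)) w) w
      have h2 := congrFun (congrFun (sum_eigproj (A := (deleteVertex X a).adjMatrix ℝ)
        (SimpleGraph.isSymm_adjMatrix _)) w) u
      rw [Matrix.sum_apply, Matrix.one_apply_eq] at h1
      rw [Matrix.sum_apply, Matrix.one_apply_ne hne,
        Finset.sum_congr rfl fun μ hμ => hG μ hμ w hw u hu w hw, h1] at h2
      exact one_ne_zero h2
    · rw [card_nbrs hreg]; exact hk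
  · intro h1
    have hz (M : Matrix {v : V // v ≠ a} {v : V // v ≠ a} ℝ) : rowDefect (nbrs X a) M = 0 := by
      rw [rowDefect_eq_zero_iff]
      have hc : (nbrs X a).card ≤ 1 := by rw [card_nbrs hreg, h1]
      intro w _ u hu u' hu'
      rw [Finset.card_le_one.1 hc u hu u' hu']
    simp [hz]

/-- On N(a) the matrix (Q\a)⁻¹ can be replaced by (L\a)⁻¹, whose row sums over N(a) are 1. So the
Schur complement is 0, and the phase -1 term drops out of the lower bound. -/
theorem elsm_signlessLap_inv_of_isBipartite (hconn : X.Connected) (hreg : X.IsRegularOfDegree k)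
    (hb : X.IsBipartite) : elsm (nbrs X a) (minorAt a (signlessLap X))⁻¹ = k := by
  have h : elsm (nbrs X a) (minorAt a (signlessLap X))⁻¹ =
      elsm (nbrs X a) (minorAt a (X.lapMatrix ℝ))⁻¹ :=
    Finset.sum_congr rfl fun u hu => Finset.sum_congr rfl fun w hw =>
      signlessLap_inv_eq_lap_inv_of_isBipartite hreg (isUnit_minorAt_lapMatrix hconn hreg) hb hu hw
  rw [h, elsm_nbrs, lap_inv_mulVec_nbrInd hconn hreg]
  simp [card_nbrs hreg]

theorem elsm_schurSq_signlessLap_inv_of_isBipartite (hconn : X.Connected)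
    (hreg : X.IsRegularOfDegree k) (hb : X.IsBipartite) :
    elsm (nbrs X a) (schurSq (minorAt a (signlessLap X))⁻¹) =
      elsm (nbrs X a) (schurSq (minorAt a (X.lapMatrix ℝ))⁻¹) := by
  rw [elsm_schurSq, elsm_schurSq]
  exact Finset.sum_congr rfl fun u hu => Finset.sum_congr rfl fun w hw => by
    rw [signlessLap_inv_eq_lap_inv_of_isBipartite hreg (isUnit_minorAt_lapMatrix hconn hreg) hb
      hu hw]

end Bounds

end MarkedWalk

end

/-! ### Specialization of the uniform bounds to bipartite and non-bipartite graphs -/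

theorem mainTheorem4 {V : Type*} [Fintype V] [DecidableEq V] (X : SimpleGraph V)
    [DecidableRel X.Adj] (k : ℕ) (hk : 0 < k) (hconn : X.Connected)
    (hreg : X.IsRegularOfDegree k) (a : V) :
    let M : ℝ := MarkedWalk.avgMixing X {a} a a
    let A := (MarkedWalk.deleteVertex X a).adjMatrix ℝ
    let ev := MarkedWalk.eigvals A
    let G := MarkedWalk.eigproj A
    let La := MarkedWalk.minorAt a (X.lapMatrix ℝ)
    let Qa := MarkedWalk.minorAt a (MarkedWalk.signlessLap X)
    let q : ℝ := (MarkedWalk.signlessLap X)⁻¹ a a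
    let J := MarkedWalk.allOnes (W := {v : V // v ≠ a})
    let N := MarkedWalk.nbrs X a
    -- the average return probability exists, and the expressions in the bounds are meaningful
    Tendsto (MarkedWalk.timeAverage X {a} a a) atTop (𝓝 M) ∧
    IsUnit La ∧ IsUnit Qa ∧ (∀ μ ∈ ev, |μ| < k) ∧
    -- bipartite graphs
    (X.IsBipartite →
      -- lower bound
      ((1 / 2 * (∑ μ ∈ ev, 1 / ((k : ℝ) ^ 2 - μ ^ 2) ^ 2 * MarkedWalk.elsm N (G μ) ^ 2) ≤ M ∧
        1 / 2 * (∑ μ ∈ ev, 1 / ((k : ℝ) ^ 2 - μ ^ 2) ^ 2 * MarkedWalk.elsm N (G μ) ^ 2)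
          = 1 / 2 * MarkedWalk.elsm N
              (∑ μ ∈ ev, (1 / ((k : ℝ) + μ) ^ 2) • (G μ * J * G μ)) ∧
        1 / 2 * MarkedWalk.elsm N (∑ μ ∈ ev, (1 / ((k : ℝ) + μ) ^ 2) • (G μ * J * G μ))
          = 1 / 2 * MarkedWalk.elsm N (Qa⁻¹ * (∑ μ ∈ ev, G μ * J * G μ) * Qa⁻¹)) ∧
       (M = 1 / 2 * (∑ μ ∈ ev, 1 / ((k : ℝ) ^ 2 - μ ^ 2) ^ 2 * MarkedWalk.elsm N (G μ) ^ 2) ↔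
        ∀ m : ℕ, ∀ w ∈ N, ∀ w' ∈ N,
          MarkedWalk.numWalks (MarkedWalk.deleteVertex X a) m w N
            = MarkedWalk.numWalks (MarkedWalk.deleteVertex X a) m w' N)) ∧
      -- upper bound
      ((M ≤ 1 / 2 * MarkedWalk.elsm N
            ((∑ μ ∈ ev, ((k : ℝ) ^ 2 / ((k : ℝ) ^ 2 - μ ^ 2) ^ 2) • MarkedWalk.schurSq (G μ))
              + MarkedWalk.schurSq (La⁻¹)) - 1 / 2 ∧
        1 / 2 * MarkedWalk.elsm N
            ((∑ μ ∈ ev, ((k : ℝ) ^ 2 / ((k : ℝ) ^ 2 - μ ^ 2) ^ 2) • MarkedWalk.schurSq (G μ))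
              + MarkedWalk.schurSq (La⁻¹)) - 1 / 2
          = 1 / 2 * MarkedWalk.elsm N
            ((k : ℝ) ^ 2 • (∑ μ ∈ ev, MarkedWalk.schurSq (La⁻¹ * Qa⁻¹ * G μ))
              + MarkedWalk.schurSq (La⁻¹)) - 1 / 2) ∧
       (M = 1 / 2 * MarkedWalk.elsm N
            ((∑ μ ∈ ev, ((k : ℝ) ^ 2 / ((k : ℝ) ^ 2 - μ ^ 2) ^ 2) • MarkedWalk.schurSq (G μ))
              + MarkedWalk.schurSq (La⁻¹)) - 1 / 2 ↔
        Nonempty (X ≃g (⊤ : SimpleGraph (Fin 2)))))) ∧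
    -- non-bipartite graphs
    (¬ X.IsBipartite →
      IsUnit (MarkedWalk.signlessLap X) ∧ 0 < q ∧
      -- lower bound
      ((1 / 2 * (∑ μ ∈ ev, 1 / ((k : ℝ) ^ 2 - μ ^ 2) ^ 2 * MarkedWalk.elsm N (G μ) ^ 2)
            + 1 / (4 * (k : ℝ) ^ 2 * q ^ 2) ≤ M ∧
        1 / 2 * (∑ μ ∈ ev, 1 / ((k : ℝ) ^ 2 - μ ^ 2) ^ 2 * MarkedWalk.elsm N (G μ) ^ 2)
            + 1 / (4 * (k : ℝ) ^ 2 * q ^ 2)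
          = 1 / 2 * (∑ μ ∈ ev, 1 / ((k : ℝ) + μ) ^ 2 * MarkedWalk.elsm N (G μ * J * G μ))
            + 1 / (4 * (k : ℝ) ^ 2 * q ^ 2) ∧
        1 / 2 * (∑ μ ∈ ev, 1 / ((k : ℝ) + μ) ^ 2 * MarkedWalk.elsm N (G μ * J * G μ))
            + 1 / (4 * (k : ℝ) ^ 2 * q ^ 2)
          = 1 / 2 * MarkedWalk.elsm N (Qa⁻¹ * (∑ μ ∈ ev, G μ * J * G μ) * Qa⁻¹)
            + 1 / (4 * (k : ℝ) ^ 2 * q ^ 2)) ∧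
       (M = 1 / 2 * (∑ μ ∈ ev, 1 / ((k : ℝ) ^ 2 - μ ^ 2) ^ 2 * MarkedWalk.elsm N (G μ) ^ 2)
            + 1 / (4 * (k : ℝ) ^ 2 * q ^ 2) ↔
        ∀ m : ℕ, ∀ w ∈ N, ∀ w' ∈ N,
          MarkedWalk.numWalks (MarkedWalk.deleteVertex X a) m w N
            = MarkedWalk.numWalks (MarkedWalk.deleteVertex X a) m w' N)) ∧
      -- upper bound
      ((M ≤ 1 / 4 * MarkedWalk.elsm N
            ((∑ μ ∈ ev, (2 * (k : ℝ) ^ 2 / ((k : ℝ) ^ 2 - μ ^ 2) ^ 2) • MarkedWalk.schurSq (G μ))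
              + MarkedWalk.schurSq (La⁻¹) + MarkedWalk.schurSq (Qa⁻¹))
            + 1 / (2 * (k : ℝ) * q) - 1 / 2 ∧
        1 / 4 * MarkedWalk.elsm N
            ((∑ μ ∈ ev, (2 * (k : ℝ) ^ 2 / ((k : ℝ) ^ 2 - μ ^ 2) ^ 2) • MarkedWalk.schurSq (G μ))
              + MarkedWalk.schurSq (La⁻¹) + MarkedWalk.schurSq (Qa⁻¹))
            + 1 / (2 * (k : ℝ) * q) - 1 / 2
          = 1 / 4 * MarkedWalk.elsm N
            ((2 * (k : ℝ) ^ 2) • (∑ μ ∈ ev, MarkedWalk.schurSq (La⁻¹ * Qa⁻¹ * G μ))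
              + MarkedWalk.schurSq (La⁻¹) + MarkedWalk.schurSq (Qa⁻¹))
            + 1 / (2 * (k : ℝ) * q) - 1 / 2 ∧
        1 / 4 * MarkedWalk.elsm N
            ((2 * (k : ℝ) ^ 2) • (∑ μ ∈ ev, MarkedWalk.schurSq (La⁻¹ * Qa⁻¹ * G μ))
              + MarkedWalk.schurSq (La⁻¹) + MarkedWalk.schurSq (Qa⁻¹))
            + 1 / (2 * (k : ℝ) * q) - 1 / 2
          ≤ 1 / 2 * MarkedWalk.elsm N
            ((k : ℝ) ^ 2 • (∑ μ ∈ ev, MarkedWalk.schurSq (La⁻¹ * Qa⁻¹ * G μ))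
              + MarkedWalk.schurSq (La⁻¹))
            + 1 / (2 * (k : ℝ) * q) - 1 / 2) ∧
       (M = 1 / 4 * MarkedWalk.elsm N
            ((∑ μ ∈ ev, (2 * (k : ℝ) ^ 2 / ((k : ℝ) ^ 2 - μ ^ 2) ^ 2) • MarkedWalk.schurSq (G μ))
              + MarkedWalk.schurSq (La⁻¹) + MarkedWalk.schurSq (Qa⁻¹))
            + 1 / (2 * (k : ℝ) * q) - 1 / 2 ↔
        Nonempty (X ≃g (⊤ : SimpleGraph (Fin 2)))))) := by
  have hk' : (0 : ℝ) < k := by exact_mod_cast hk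
  have hM := MarkedWalk.avgMixing_eq (a := a) hk hconn hreg
  have hrv := MarkedWalk.tendsto_timeAverage (a := a) hk hconn hreg
  have hlb := MarkedWalk.lowerBound_le (a := a) hk hreg
  have hlbe := MarkedWalk.returnValue_eq_lowerBound_iff (a := a) hk hconn hreg
  have hub := MarkedWalk.le_upperBound (a := a) hk hconn hreg
  have hube := MarkedWalk.returnValue_eq_upperBound_iff (a := a) hk hconn hreg
  rw [← hM] at hrv hlb hlbe hub hube
  have hJ : ∑ μ ∈ MarkedWalk.eigvals ((MarkedWalk.deleteVertex X a).adjMatrix ℝ),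
      1 / ((k : ℝ) ^ 2 - μ ^ 2) ^ 2 * MarkedWalk.elsm (MarkedWalk.nbrs X a)
        (MarkedWalk.eigproj ((MarkedWalk.deleteVertex X a).adjMatrix ℝ) μ) ^ 2 =
      ∑ μ ∈ MarkedWalk.eigvals ((MarkedWalk.deleteVertex X a).adjMatrix ℝ),
        1 / ((k : ℝ) + μ) ^ 2 * MarkedWalk.elsm (MarkedWalk.nbrs X a)
          (MarkedWalk.eigproj ((MarkedWalk.deleteVertex X a).adjMatrix ℝ) μ * MarkedWalk.allOnes *
            MarkedWalk.eigproj ((MarkedWalk.deleteVertex X a).adjMatrix ℝ) μ) :=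
    Finset.sum_congr rfl fun μ hμ => MarkedWalk.elsm_eigproj_mul_allOnes hconn hreg hμ
  intro M A ev G La Qa q J N
  refine ⟨hrv, MarkedWalk.isUnit_minorAt_lapMatrix hconn hreg,
    MarkedWalk.isUnit_minorAt_signlessLap hconn hreg,
    fun μ hμ => MarkedWalk.abs_eigval_lt hconn hreg hμ, fun hb => ?_, fun hb => ?_⟩
  · have hlow : MarkedWalk.lowerBound X a k =
        1 / 2 * (∑ μ ∈ ev, 1 / ((k : ℝ) ^ 2 - μ ^ 2) ^ 2 * MarkedWalk.elsm N (G μ) ^ 2) := by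
      rw [MarkedWalk.lowerBound, MarkedWalk.elsm_signlessLap_inv_of_isBipartite hconn hreg hb,
        sub_self, zero_pow two_ne_zero, zero_div, add_zero]
    have hupp : MarkedWalk.upperBound X a k = 1 / 2 * MarkedWalk.elsm N
        ((∑ μ ∈ ev, ((k : ℝ) ^ 2 / ((k : ℝ) ^ 2 - μ ^ 2) ^ 2) • MarkedWalk.schurSq (G μ))
          + MarkedWalk.schurSq (La⁻¹)) - 1 / 2 := by
      rw [MarkedWalk.upperBound, MarkedWalk.elsm_signlessLap_inv_of_isBipartite hconn hreg hb,
        MarkedWalk.sum_smul_schurSq_eq hconn hreg, MarkedWalk.sum_smul_schurSq_eq hconn hreg,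
        MarkedWalk.elsm_add, MarkedWalk.elsm_add, MarkedWalk.elsm_add, MarkedWalk.elsm_smul,
        MarkedWalk.elsm_smul,
        MarkedWalk.elsm_schurSq_signlessLap_inv_of_isBipartite hconn hreg hb]
      ring
    rw [hlow] at hlb hlbe
    rw [hupp] at hub hube
    refine ⟨⟨⟨hlb, ?_, ?_⟩, hlbe⟩, ⟨hub, ?_⟩, hube⟩
    · rw [hJ, MarkedWalk.elsm_sum]
      simp only [MarkedWalk.elsm_smul]
      rfl
    · rw [MarkedWalk.signlessLap_inv_mul_sum_mul hconn hreg]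
    · rw [MarkedWalk.sum_smul_schurSq_eq hconn hreg]
  · have hq := MarkedWalk.schur_mul_signlessLap_inv (a := a) hconn hreg hb
    have hnn := MarkedWalk.schur_nonneg (a := a) hconn hreg
    -- The product of q with the nonnegative Schur complement is 1, so both are positive and
    -- reciprocal.
    have hqpos : 0 < q := by
      refine pos_of_mul_pos_right (a := (k : ℝ) - MarkedWalk.elsm N Qa⁻¹) ?_ hnn
      rw [hq]; exact one_pos
    have hs : (k : ℝ) - MarkedWalk.elsm N Qa⁻¹ = 1 / q := eq_one_div_of_mul_eq_one_left hq
    have hlow : MarkedWalk.lowerBound X a k =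
        1 / 2 * (∑ μ ∈ ev, 1 / ((k : ℝ) ^ 2 - μ ^ 2) ^ 2 * MarkedWalk.elsm N (G μ) ^ 2)
          + 1 / (4 * (k : ℝ) ^ 2 * q ^ 2) := by
      rw [MarkedWalk.lowerBound, hs]
      congr 1
      field_simp
    have hupp : MarkedWalk.upperBound X a k = 1 / 4 * MarkedWalk.elsm N
            ((∑ μ ∈ ev, (2 * (k : ℝ) ^ 2 / ((k : ℝ) ^ 2 - μ ^ 2) ^ 2) • MarkedWalk.schurSq (G μ))
              + MarkedWalk.schurSq (La⁻¹) + MarkedWalk.schurSq (Qa⁻¹))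
            + 1 / (2 * (k : ℝ) * q) - 1 / 2 := by
      rw [MarkedWalk.upperBound, hs]
      congr 2
      field_simp
    rw [hlow] at hlb hlbe
    rw [hupp] at hub hube
    refine ⟨MarkedWalk.isUnit_signlessLap hconn hreg hb, hqpos, ⟨⟨hlb, ?_, ?_⟩, hlbe⟩,
      ⟨hub, ?_, ?_⟩, hube⟩
    · rw [hJ]
    · rw [MarkedWalk.signlessLap_inv_mul_sum_mul hconn hreg, MarkedWalk.elsm_sum]
      simp only [MarkedWalk.elsm_smul]
      rfl
    · rw [MarkedWalk.sum_smul_schurSq_eq hconn hreg]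
    · have hle := MarkedWalk.elsm_schurSq_signlessLap_inv_le (a := a) hk hconn hreg
      rw [MarkedWalk.elsm_add, MarkedWalk.elsm_add, MarkedWalk.elsm_add, MarkedWalk.elsm_smul,
        MarkedWalk.elsm_smul]
      linarith
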